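/- Let $f:\mathbb R^D\times\mathbb R^I\to\mathbb R^O$ be a parametrized model with weights $w\in\mathbb R^D$, let $\mathcal X=\{x_1,\dots,x_N\}\subset\mathbb R^I$ be a finite training set with labels $y_1,\dots,y_N$, and let $p(y\mid z)>0$, $z\in\mathbb R^O$, be a likelihood such that $z\mapsto\log p(y\mid z)$ is $C^2$ with $\nabla_z^2\log p(y\mid z)$ independent of $y$. Assume that $w\mapsto f(w,x_n)$ is differentiable for each $n$, and let $J_w\in\mathbb R^{NO\times D}$ be the stacking of the Jacobians $J_w(x_n)=\partial_w f(w,x_n)$. Let $H_w\in\mathbb R^{NO\times NO}$ be the block diagonal matrix with blocks $-\nabla_z^2\log p(y_n\mid z)|_{z=f(w,x_n)}$. Put $\mathrm{GGN}_w=J_w^\top H_wJ_w$ and $\mathrm{NTK}_w=H_w^{1/2}J_wJ_w^\top H_w^{1/2}$. Assume: 1. $H_w$ is positive definite for every $w$; 2. there are constants $0<l$ and $L$ with $l\|v\|\le\|\mathrm{NTK}_w v\|\le L\|v\|$ for all $v\in\mathbb R^{NO}$ and all $w\in\mathbb R^D$; 3. $w\mapsto J_w(x_n)$ is Lipschitz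 for every $n$. Define the pullback (GGN) geodesic distance $$d_{f^*H}(w_0,w_1)=\inf_\gamma\int_0^1\sqrt{\gamma'(t)^\top\,\mathrm{GGN}_{\gamma(t)}\,\gamma'(t)}\;dt,$$ where the infimum is over smooth curves $\gamma:[0,1]\to\mathbb R^D$ with $\gamma(0)=w_0$ and $\gamma(1)=w_1$. Write $w\sim w'$ if there is a piecewise differentiable $\gamma:[0,1]\to\mathbb R^D$ (differentiable on each closed interval of some finite partition of $[0,1]$) with $\gamma(0)=w$, $\gamma(1)=w'$ and $f(\gamma(t),x)=f(w,x)$ for all $t\in[0,1]$ and $x\in\mathcal X$. This is an equivalence relation; let $\mathcal P=\mathbb R^D/\!\sim$, let $[w]$ be the class of $w$, and define $$d_{\mathcal P}([w],[w'])=\inf\sum_{i=1}^n\|p_i-q_i\|,$$ where the infimum is over all $n\ge1$ and all $p_1,\dots,p_n,q_1,\dots,q_n\in\mathbb R^D$ with $[w]=[p_1]$, $[p_{i+1}]=[q_i]$ for $1\le i<n$, and $[q_n]=[w']$. Then for all $w_0,w_1\in\mathbb R^D$, $$d_{f^*H}(w_0,w_1)=0\iff[w_0]=[w_1]\iff d_{\mathcal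 P}([w_0],[w_1])=0 .$$ -/

import Mathlib

open Set
open scoped NNReal Matrix MatrixOrder ContDiff

/-! ### Reparameterizations and the quotient of effective parameters -/

/-- The weights `w'` with `f(w', x) = f(w, x)`. -/
def pointReparams {W U V : Type*} (f : W → U → V) (x : U) (w : W) : Set W :=
  {w' | f w' x = f w x}

/-- The weights whose predictions agree with those of `w` at every point of `X`. -/
def setReparams {W U V : Type*} (f : W → U → V) (X : Set U) (w : W) : Set W :=
  ⋂ x ∈ X, pointReparams f x w

/-- A curve on `[0,1]` is piecewise differentiable if there is a finite partition
`0 = t 0 < t 1 < ⋯ < t k = 1` such that the restriction of the curve to each closed interval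
`[t i, t (i+1)]` is differentiable (one-sidedly at its end points). Such a curve is continuous
on `[0,1]`. -/
def PiecewiseDifferentiable {W : Type*} [NormedAddCommGroup W] [NormedSpace ℝ W]
    (γ : ℝ → W) : Prop :=
  ∃ (k : ℕ) (t : ℕ → ℝ), t 0 = 0 ∧ t k = 1 ∧ (∀ i < k, t i < t (i + 1)) ∧
    ∀ i < k, DifferentiableOn ℝ γ (Icc (t i) (t (i + 1)))

/-- The weights `w'` that are joined to `w` by a piecewise differentiable curve along which the
predictions on `X` do not change. -/
def smoothReparams {W U V : Type*} [NormedAddCommGroup W] [NormedSpace ℝ W]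
    (f : W → U → V) (X : Set U) (w : W) : Set W :=
  {w' | ∃ γ : ℝ → W, PiecewiseDifferentiable γ ∧ γ 0 = w ∧ γ 1 = w' ∧
    ∀ t ∈ Icc (0 : ℝ) 1, γ t ∈ setReparams f X w}

theorem mem_setReparams {W U V : Type*} {f : W → U → V} {X : Set U} {w w' : W} :
    w' ∈ setReparams f X w ↔ ∀ x ∈ X, f w' x = f w x := by
  simp [setReparams, pointReparams]

theorem smoothReparams_refl {W U V : Type*} [NormedAddCommGroup W] [NormedSpace ℝ W]
    (f : W → U → V) (X : Set U) (w : W) : w ∈ smoothReparams f X w := by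
  refine ⟨fun _ => w, ⟨1, fun i => i, by simp, by simp, fun i _ => by simp, fun i _ => ?_⟩,
    rfl, rfl, fun t _ => mem_setReparams.2 fun x _ => rfl⟩
  exact differentiableOn_const _

theorem smoothReparams_symm {W U V : Type*} [NormedAddCommGroup W] [NormedSpace ℝ W]
    {f : W → U → V} {X : Set U} {w w' : W} (h : w' ∈ smoothReparams f X w) :
    w ∈ smoothReparams f X w' := by
  obtain ⟨γ, ⟨k, t, h0, h1, hlt, hd⟩, g0, g1, hγ⟩ := h
  refine ⟨fun s => γ (1 - s), ⟨k, fun i => 1 - t (k - i), by simp [h1], by simp [h0], ?_, ?_⟩,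
    by simpa using g1, by simpa using g0, ?_⟩
  · intro i hi
    have h2 := hlt (k - (i + 1)) (by omega)
    rw [show k - (i + 1) + 1 = k - i by omega] at h2
    change 1 - t (k - i) < 1 - t (k - (i + 1))
    linarith
  · intro i hi
    have h2 := hd (k - (i + 1)) (by omega)
    rw [show k - (i + 1) + 1 = k - i by omega] at h2
    refine h2.comp (f := fun s : ℝ => 1 - s) (by fun_prop) ?_
    intro s hs
    have hs1 : 1 - t (k - i) ≤ s := hs.1
    have hs2 : s ≤ 1 - t (k - (i + 1)) := hs.2
    exact ⟨by linarith, by linarith⟩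
  · intro s hs
    have e1 := mem_setReparams.1 (hγ (1 - s) ⟨by linarith [hs.2], by linarith [hs.1]⟩)
    have e2 := mem_setReparams.1 (hγ 1 ⟨by norm_num, le_refl _⟩)
    exact mem_setReparams.2 fun x hx => by rw [e1 x hx, ← g1, e2 x hx]

theorem smoothReparams_trans {W U V : Type*} [NormedAddCommGroup W] [NormedSpace ℝ W]
    {f : W → U → V} {X : Set U} {w₀ w₁ w₂ : W} (h : w₁ ∈ smoothReparams f X w₀)
    (h' : w₂ ∈ smoothReparams f X w₁) : w₂ ∈ smoothReparams f X w₀ := by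
  obtain ⟨a, ⟨k, t, t0, t1, tlt, ta⟩, a0, a1, ha⟩ := h
  obtain ⟨b, ⟨m, s, s0, s1, slt, sb⟩, b0, b1, hb⟩ := h'
  have tmono : ∀ i, i ≤ k → t i ≤ 1 := by
    intro i hi
    rw [← t1]
    induction hi using Nat.decreasingInduction with
    | self => exact le_refl _
    | of_succ j hj ih => exact (tlt j hj).le.trans ih
  have smono : ∀ i, i ≤ m → 0 ≤ s i := by
    intro i
    induction i with
    | zero => intro _; exact s0.ge
    | succ j ih => intro hj; exact (ih (by omega)).trans (slt j (by omega)).le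
  refine ⟨fun r => if r ≤ 1 / 2 then a (2 * r) else b (2 * r - 1),
    ⟨k + m, fun i => if i ≤ k then t i / 2 else (1 + s (i - k)) / 2, ?_, ?_, ?_, ?_⟩, ?_, ?_, ?_⟩
  · simp [t0]
  · rcases Nat.eq_zero_or_pos m with rfl | hm
    · rw [s0] at s1; norm_num at s1
    · have : ¬ (k + m ≤ k) := by omega
      simp [s1, this]
  · intro i hi
    by_cases h1 : i + 1 ≤ k
    · have h2 : i ≤ k := by omega
      simp only [h1, h2, if_true]
      linarith [tlt i (by omega)]
    · by_cases h2 : i ≤ k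
      · obtain rfl : i = k := by omega
        have := slt 0 (by omega)
        simp only [h1, h2, if_true, if_false, t1, Nat.add_sub_cancel_left]
        rw [s0] at this
        norm_num at this ⊢
        linarith
      · have := slt (i - k) (by omega)
        simp only [h1, h2, if_false]
        rw [show i + 1 - k = i - k + 1 by omega]
        linarith
  · intro i hi
    by_cases h1 : i + 1 ≤ k
    · have h2 : i ≤ k := by omega
      simp only [h1, h2, if_true]
      have hd : DifferentiableOn ℝ (fun r : ℝ => a (2 * r)) (Icc (t i / 2) (t (i + 1) / 2)) := by
        refine (ta i (by omega)).comp (f := fun r : ℝ => 2 * r) (by fun_prop) ?_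
        intro r hr
        exact ⟨by linarith [hr.1], by linarith [hr.2]⟩
      refine hd.congr fun r hr => ?_
      rw [if_pos (by linarith [hr.2, tmono _ h1])]
    · have key : DifferentiableOn ℝ
          (fun r : ℝ => if r ≤ 1 / 2 then a (2 * r) else b (2 * r - 1))
          (Icc ((1 + s (i - k)) / 2) ((1 + s (i - k + 1)) / 2)) := by
        have hd : DifferentiableOn ℝ (fun r : ℝ => b (2 * r - 1))
            (Icc ((1 + s (i - k)) / 2) ((1 + s (i - k + 1)) / 2)) := by
          refine (sb (i - k) (by omega)).comp (f := fun r : ℝ => 2 * r - 1) (by fun_prop) ?_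
          intro r hr
          exact ⟨by linarith [hr.1], by linarith [hr.2]⟩
        refine hd.congr fun r hr => ?_
        have h3 := smono (i - k) (by omega)
        split_ifs with h4
        · have h5 : r = 1 / 2 := le_antisymm h4 (by linarith [hr.1])
          subst h5
          norm_num [a1, b0]
        · rfl
      by_cases h2 : i ≤ k
      · obtain rfl : i = k := by omega
        simp only [h1, h2, if_true, if_false, t1, Nat.add_sub_cancel_left]
        simpa [s0] using key
      · simp only [h1, h2, if_false]
        rwa [show i + 1 - k = i - k + 1 by omega]
  · simp [a0]
  · norm_num [b1]
  · intro r hr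
    refine mem_setReparams.2 fun x hx => ?_
    dsimp only
    split_ifs with h1
    · exact mem_setReparams.1 (ha (2 * r) ⟨by linarith [hr.1], by linarith⟩) x hx
    · push Not at h1
      have e1 := mem_setReparams.1 (hb (2 * r - 1) ⟨by linarith, by linarith [hr.2]⟩) x hx
      have e2 := mem_setReparams.1 (ha 1 ⟨by norm_num, le_refl _⟩) x hx
      rw [e1, ← a1, e2]

/-- `w ∼ w'` iff `w'` belongs to `smoothReparams f X w`. -/
def reparamSetoid {W U V : Type*} [NormedAddCommGroup W] [NormedSpace ℝ W]
    (f : W → U → V) (X : Set U) : Setoid W where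
  r w w' := w' ∈ smoothReparams f X w
  iseqv := ⟨smoothReparams_refl f X, smoothReparams_symm, smoothReparams_trans⟩

/-- The quotient space of effective parameters. -/
def EffectiveParams {W U V : Type*} [NormedAddCommGroup W] [NormedSpace ℝ W]
    (f : W → U → V) (X : Set U) : Type _ :=
  Quotient (reparamSetoid f X)

/-- The equivalence class `[w]`. -/
def effClass {W U V : Type*} [NormedAddCommGroup W] [NormedSpace ℝ W]
    (f : W → U → V) (X : Set U) (w : W) : EffectiveParams f X :=
  Quotient.mk (reparamSetoid f X) w

/-- The quotient distance: the infimum of `‖p 0 - q 0‖ + ⋯ + ‖p n - q n‖` over all finite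
(nonempty) sequences with `a = [p 0]`, `[p (i+1)] = [q i]` and `[q n] = b`. -/
noncomputable def quotientDist {W U V : Type*} [NormedAddCommGroup W] [NormedSpace ℝ W]
    (f : W → U → V) (X : Set U) (a b : EffectiveParams f X) : ℝ :=
  sInf {r : ℝ | ∃ (n : ℕ) (p q : Fin (n + 1) → W),
    a = effClass f X (p 0) ∧
    (∀ i : Fin n, effClass f X (p i.succ) = effClass f X (q i.castSucc)) ∧
    effClass f X (q (Fin.last n)) = b ∧
    r = ∑ i, ‖p i - q i‖}

/-! ### The GGN pseudo-metric and its geodesic distance -/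

/-- The stacking of the per-datum Jacobians `∂_w f(w, x n)`, an `NO × D` matrix. -/
noncomputable def stackedJacobian {D I O N : ℕ}
    (f : EuclideanSpace ℝ (Fin D) → EuclideanSpace ℝ (Fin I) → EuclideanSpace ℝ (Fin O))
    (x : Fin N → EuclideanSpace ℝ (Fin I)) (w : EuclideanSpace ℝ (Fin D)) :
    Matrix (Fin N × Fin O) (Fin D) ℝ :=
  Matrix.of fun k j =>
    fderiv ℝ (fun v => f v (x k.1)) w (EuclideanSpace.single j 1) k.2

/-- The Hessian matrix at `z` of the negative log-likelihood `z ↦ -log p(y | z)`, for a fixed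
label `y`; here `p y z` stands for `p(y | z)`. -/
noncomputable def negLogLikHessian {O : ℕ} {Y : Type*} (p : Y → EuclideanSpace ℝ (Fin O) → ℝ)
    (y : Y) (z : EuclideanSpace ℝ (Fin O)) : Matrix (Fin O) (Fin O) ℝ :=
  Matrix.of fun a b =>
    -(fderiv ℝ (fun z' => fderiv ℝ (fun u => Real.log (p y u)) z') z
      (EuclideanSpace.single a 1) (EuclideanSpace.single b 1))

/-- The block diagonal `NO × NO` matrix with blocks `-∂² log p(y n | ·)` at `f(w, x n)`. -/
noncomputable def stackedHessian {D I O N : ℕ} {Y : Type*}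
    (f : EuclideanSpace ℝ (Fin D) → EuclideanSpace ℝ (Fin I) → EuclideanSpace ℝ (Fin O))
    (p : Y → EuclideanSpace ℝ (Fin O) → ℝ)
    (x : Fin N → EuclideanSpace ℝ (Fin I)) (y : Fin N → Y) (w : EuclideanSpace ℝ (Fin D)) :
    Matrix (Fin N × Fin O) (Fin N × Fin O) ℝ :=
  Matrix.of fun k k' =>
    if k.1 = k'.1 then negLogLikHessian p (y k.1) (f w (x k.1)) k.2 k'.2 else 0

/-- The generalized Gauss-Newton matrix `Jᵀ H J`, i.e. the pullback pseudo-metric at `w`. -/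
noncomputable def ggn {D I O N : ℕ} {Y : Type*}
    (f : EuclideanSpace ℝ (Fin D) → EuclideanSpace ℝ (Fin I) → EuclideanSpace ℝ (Fin O))
    (p : Y → EuclideanSpace ℝ (Fin O) → ℝ)
    (x : Fin N → EuclideanSpace ℝ (Fin I)) (y : Fin N → Y) (w : EuclideanSpace ℝ (Fin D)) :
    Matrix (Fin D) (Fin D) ℝ :=
  (stackedJacobian f x w)ᵀ * stackedHessian f p x y w * stackedJacobian f x w

/-- The neural tangent kernel matrix `H^{1/2} J Jᵀ H^{1/2}`. -/
noncomputable def ntk {D I O N : ℕ} {Y : Type*}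
    (f : EuclideanSpace ℝ (Fin D) → EuclideanSpace ℝ (Fin I) → EuclideanSpace ℝ (Fin O))
    (p : Y → EuclideanSpace ℝ (Fin O) → ℝ)
    (x : Fin N → EuclideanSpace ℝ (Fin I)) (y : Fin N → Y) (w : EuclideanSpace ℝ (Fin D)) :
    Matrix (Fin N × Fin O) (Fin N × Fin O) ℝ :=
  CFC.sqrt (stackedHessian f p x y w) * stackedJacobian f x w * (stackedJacobian f x w)ᵀ *
    CFC.sqrt (stackedHessian f p x y w)

/-- The length on `[0,1]` of a curve with respect to a field `g` of quadratic forms. -/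
noncomputable def metricLength {D : ℕ}
    (g : EuclideanSpace ℝ (Fin D) → Matrix (Fin D) (Fin D) ℝ)
    (γ : ℝ → EuclideanSpace ℝ (Fin D)) : ℝ :=
  ∫ t in (0 : ℝ)..1,
    √((derivWithin γ (Icc 0 1) t).ofLp ⬝ᵥ (g (γ t) *ᵥ (derivWithin γ (Icc 0 1) t).ofLp))

/-- The geodesic distance: the infimum of the lengths of the smooth curves on `[0,1]` from `w₀`
to `w₁`. -/
noncomputable def metricGeodesicDist {D : ℕ}
    (g : EuclideanSpace ℝ (Fin D) → Matrix (Fin D) (Fin D) ℝ)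
    (w₀ w₁ : EuclideanSpace ℝ (Fin D)) : ℝ :=
  sInf {r : ℝ | ∃ γ : ℝ → EuclideanSpace ℝ (Fin D),
    ContDiffOn ℝ ∞ γ (Icc 0 1) ∧ γ 0 = w₀ ∧ γ 1 = w₁ ∧ r = metricLength g γ}

/-! Let `F` be the stacked predictions (`stackedModel`). The Hessian depends on `w` only through `F
w`, so on a whole tube `‖F w - F w₀‖ < ρ`, which need not be bounded, it is uniformly comparable to
the identity. There the two NTK bounds make `DF` bounded with bounded right inverses, and make the
GGN speed comparable to `‖DF(w) h‖` (`exists_uniform_bounds_near_fiber`).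

As `DF` is Lipschitz, the implicit function theorem then holds with one radius for all base points
in the tube (`exists_fiber_chart`): points of the fibre of `F w₀` closer than some constant are
joined inside it, and points of the tube are close to it. Assigning to a point of a thinner tube the
class of a nearby fibre point gives a function `c` that is constant at a uniform scale `δ`
(`exists_locally_constant_class`). If either distance from `w₀` to `w₁` vanishes, curves of small
GGN length, respectively chains of small total length, stay in the tube. Hence `c w₀ = c w₁`;
letting the length tend to zero gives `F w₁ = F w₀`, so both endpoints lie on the fibre, where `c`
is the class itself.

Conversely, equal classes trivially have quotient distance zero. For the GGN distance, the joining
curve is only piecewise differentiable and so is not itself a competitor in the infimum. Instead,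
two nearby points of one fibre are at GGN distance `O(‖u - v‖²)`
(`metricGeodesicDist_le_sq_of_map_eq`), so the distance to `w₀` has zero derivative along the curve.
-/

/-! ### Charts straightening the level sets of a map, with uniform radius -/

open Metric in
/-- Near a point `w` at which the derivative of `F` has a bounded right inverse, there is a chart
`e`, fixing `w`, in which the level set of `F` through `w` is `w + ker DF(w)`. -/
theorem exists_fiber_chart {E V : Type*} [NormedAddCommGroup E] [NormedSpace ℝ E]
    [CompleteSpace E] [NormedAddCommGroup V] [NormedSpace ℝ V] {F : E → V}
    (hF : Differentiable ℝ F) {K : ℝ≥0} (hK : LipschitzWith K (fderiv ℝ F)) {M r : ℝ}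
    (hr : 0 < r) (hMr : M * K * r ≤ 1 / 2) {w : E} {R : V →L[ℝ] E}
    (hR : ∀ v, fderiv ℝ F w (R v) = v) (hM : ‖R‖ ≤ M) :
    ∃ e : OpenPartialHomeomorph E E, e.source = ball w r ∧ e w = w ∧ ball w (r / 2) ⊆ e.target ∧
      (∀ y ∈ e.target, DifferentiableAt ℝ e.symm y) ∧
      (∀ u, fderiv ℝ F w (e u - w) = F u - F w) ∧
      ∀ u ∈ ball w r, ‖u - w‖ ≤ 2 * ‖e u - w‖ ∧ ‖e u - w‖ ≤ 2 * ‖u - w‖ := by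
  set A := fderiv ℝ F w with hA
  -- Since `A ∘ R = id`, this choice gives `A (G u - w) = F u - F w`. Its derivative is the identity
  -- plus `R ∘ (DF(u) - A)`, a perturbation of norm at most `M * K * r ≤ 1 / 2` on the ball.
  let G : E → E := fun u => u + R (F u - F w - A (u - w))
  have hGd : ∀ u, HasFDerivAt G (ContinuousLinearMap.id ℝ E + R.comp (fderiv ℝ F u - A)) u := by
    intro u
    have h1 : HasFDerivAt (fun u => F u - F w - A (u - w)) (fderiv ℝ F u - A) u := by
      have h2 := ((hF u).hasFDerivAt.sub_const (F w)).sub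
        (A.hasFDerivAt.comp u ((hasFDerivAt_id u).sub_const w))
      exact h2.congr_fderiv (by simp)
    exact (hasFDerivAt_id u).add (R.hasFDerivAt.comp u h1)
  have hsmall : ∀ u ∈ ball w r, ‖R.comp (fderiv ℝ F u - A)‖ ≤ 1 / 2 := by
    intro u hu
    have h1 : ‖fderiv ℝ F u - A‖ ≤ K * r := by
      have := hK.dist_le_mul u w
      rw [dist_eq_norm] at this
      exact this.trans (mul_le_mul_of_nonneg_left (mem_ball.1 hu).le K.2)
    calc _ ≤ ‖R‖ * ‖fderiv ℝ F u - A‖ := ContinuousLinearMap.opNorm_comp_le _ _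
      _ ≤ M * (K * r) := mul_le_mul hM h1 (norm_nonneg _) ((norm_nonneg _).trans hM)
      _ ≤ 1 / 2 := by linarith
  have happ : ApproximatesLinearOn G (ContinuousLinearEquiv.refl ℝ E : E →L[ℝ] E) (ball w r)
      (1 / 2) := by
    intro u hu v hv
    refine (convex_ball w r).norm_image_sub_le_of_norm_hasFDerivWithin_le'
      (fun z _ => (hGd z).hasFDerivWithinAt) (fun z hz => ?_) hv hu
    simpa using! hsmall z hz
  have hc : Subsingleton E ∨ (1 / 2 : ℝ≥0) <
      ‖((ContinuousLinearEquiv.refl ℝ E).symm : E →L[ℝ] E)‖₊⁻¹ := by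
    rcases subsingleton_or_nontrivial E with h | h
    · exact Or.inl h
    · right
      have : ‖((ContinuousLinearEquiv.refl ℝ E).symm : E →L[ℝ] E)‖₊ = 1 := by
        exact ContinuousLinearMap.nnnorm_id (𝕜 := ℝ) (E := E)
      rw [this, inv_one]
      exact NNReal.half_lt_self one_ne_zero
  have hGw : G w = w := by simp [G]
  let e := happ.toOpenPartialHomeomorph G (ball w r) hc isOpen_ball
  refine ⟨e, rfl, hGw, ?_, ?_, ?_, ?_⟩
  · intro y hy
    let Ri : (ContinuousLinearEquiv.refl ℝ E : E →L[ℝ] E).NonlinearRightInverse :=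
      ⟨id, 1, fun y => by simp, fun y => rfl⟩
    have hyr : 2 * dist y w < r := by rw [mem_ball] at hy; linarith
    -- The image of a ball of radius `ε` contains the ball of radius `(1 - 1/2) ε`; `ε = 2 * dist y
    -- w` is just enough to reach `y`.
    have h1 := happ.surjOn_closedBall_of_nonlinearRightInverse Ri
      (ε := 2 * dist y w) (b := w) (by positivity) (closedBall_subset_ball hyr)
    have h2 : y ∈ closedBall (G w) ((((Ri.nnnorm : ℝ≥0) : ℝ)⁻¹ - ((1 / 2 : ℝ≥0) : ℝ)) *
        (2 * dist y w)) := by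
      rw [hGw, mem_closedBall]
      simp only [Ri]
      norm_num
      linarith
    obtain ⟨x, hx, hxy⟩ := h1 h2
    exact ⟨x, closedBall_subset_ball hyr hx, hxy⟩
  · intro y hy
    have hx : e.symm y ∈ ball w r := e.map_target hy
    -- The derivative of the chart is `1 - T` with `‖T‖ < 1`, invertible by the Neumann series.
    let T : E →L[ℝ] E := -(R.comp (fderiv ℝ F (e.symm y) - A))
    have hT : ‖T‖ < 1 := by
      have := hsmall _ hx
      rw [norm_neg]
      linarith
    let U : E ≃L[ℝ] E := ContinuousLinearEquiv.unitsEquiv ℝ E (Units.oneSub T hT)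
    have hU : HasFDerivAt e (U : E →L[ℝ] E) (e.symm y) := by
      have h := hGd (e.symm y)
      refine h.congr_fderiv (ContinuousLinearMap.ext fun v => ?_)
      change v + R.comp (fderiv ℝ F (e.symm y) - A) v = v - T v
      simp only [T, neg_apply]
      abel
    exact (e.hasFDerivAt_symm hy hU).differentiableAt
  · intro u
    change A (u + R (F u - F w - A (u - w)) - w) = _
    rw [show u + R (F u - F w - A (u - w)) - w = (u - w) + R (F u - F w - A (u - w)) by abel,
      map_add, hR]
    abel
  · intro u hu
    have h := happ u hu w (mem_ball_self hr)
    rw [hGw] at h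
    have h' : ‖(e u - w) - (u - w)‖ ≤ 1 / 2 * ‖u - w‖ := by simpa using! h
    constructor
    · have := norm_sub_norm_le (u - w) (e u - w)
      rw [norm_sub_rev (u - w)] at this
      linarith
    · have := norm_sub_norm_le (e u - w) (u - w)
      linarith [norm_nonneg (u - w)]

theorem piecewiseDifferentiable_of_differentiableOn {W : Type*} [NormedAddCommGroup W]
    [NormedSpace ℝ W] {γ : ℝ → W} (h : DifferentiableOn ℝ γ (Icc 0 1)) :
    PiecewiseDifferentiable γ :=
  ⟨1, fun i => i, by simp, by simp, fun i _ => by simp, fun i hi => by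
    obtain rfl : i = 0 := by omega
    simpa using h⟩

open Metric in
/-- Nearby points of a level set of `F` are joined by a differentiable curve in it. -/
theorem exists_curve_in_fiber {E V : Type*} [NormedAddCommGroup E] [NormedSpace ℝ E]
    [CompleteSpace E] [NormedAddCommGroup V] [NormedSpace ℝ V] {F : E → V}
    (hF : Differentiable ℝ F) {K : ℝ≥0} (hK : LipschitzWith K (fderiv ℝ F)) {M r : ℝ}
    (hr : 0 < r) (hMr : M * K * r ≤ 1 / 2) {w u : E} {R : V →L[ℝ] E}
    (hR : ∀ v, fderiv ℝ F w (R v) = v) (hM : ‖R‖ ≤ M) (hFu : F u = F w) (hu : ‖u - w‖ < r / 4) :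
    ∃ γ : ℝ → E, PiecewiseDifferentiable γ ∧ γ 0 = w ∧ γ 1 = u ∧
      ∀ t ∈ Icc (0 : ℝ) 1, F (γ t) = F w := by
  obtain ⟨e, hs, hew, ht, hd, hA, hb⟩ := exists_fiber_chart hF hK hr hMr hR hM
  have hur : u ∈ e.source := by rw [hs, mem_ball, dist_eq_norm]; linarith
  have hwr : w ∈ e.source := by rw [hs]; exact mem_ball_self hr
  have hline : ∀ t ∈ Icc (0 : ℝ) 1, w + t • (e u - w) ∈ e.target := by
    intro t ht'
    apply ht
    rw [mem_ball, dist_eq_norm, add_sub_cancel_left, norm_smul, Real.norm_of_nonneg ht'.1]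
    have h1 := (hb u (hs ▸ hur)).2
    have h2 := mul_le_of_le_one_left (norm_nonneg (e u - w)) ht'.2
    linarith
  -- In the chart the fibre is affine, so the straight segment stays in it. The bound `r / 4` on `‖u
  -- - w‖` doubles to `r / 2` in the chart, which keeps the segment in the target.
  refine ⟨fun t => e.symm (w + t • (e u - w)), piecewiseDifferentiable_of_differentiableOn ?_,
    ?_, ?_, ?_⟩
  · intro t ht'
    exact ((hd _ (hline t ht')).comp t (by fun_prop)).differentiableWithinAt
  · have := e.left_inv hwr
    simpa [hew] using this
  · simpa using e.left_inv hur
  · intro t ht'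
    have h1 := hA (e.symm (w + t • (e u - w)))
    rw [e.right_inv (hline t ht'), add_sub_cancel_left, map_smul, hA u, hFu, sub_self,
      smul_zero] at h1
    exact (sub_eq_zero.1 h1.symm)

open Metric in
/-- Points at which `F` is close to `z` are close to the level set of `z`. -/
theorem exists_near_mem_fiber {E V : Type*} [NormedAddCommGroup E] [NormedSpace ℝ E]
    [CompleteSpace E] [NormedAddCommGroup V] [NormedSpace ℝ V] {F : E → V}
    (hF : Differentiable ℝ F) {K : ℝ≥0} (hK : LipschitzWith K (fderiv ℝ F)) {M r : ℝ}
    (hr : 0 < r) (hMr : M * K * r ≤ 1 / 2) {w : E} {z : V} {R : V →L[ℝ] E}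
    (hR : ∀ v, fderiv ℝ F w (R v) = v) (hM : ‖R‖ ≤ M) (hz : M * ‖F w - z‖ < r / 2) :
    ∃ u, F u = z ∧ ‖u - w‖ ≤ 2 * M * ‖F w - z‖ := by
  obtain ⟨e, hs, hew, ht, hd, hA, hb⟩ := exists_fiber_chart hF hK hr hMr hR hM
  have hy : ‖R (z - F w)‖ ≤ M * ‖F w - z‖ := by
    rw [norm_sub_rev]
    exact R.le_of_opNorm_le hM _
  have hyt : w + R (z - F w) ∈ e.target := by
    apply ht
    rw [mem_ball, dist_eq_norm, add_sub_cancel_left]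
    exact hy.trans_lt hz
  -- A single Newton step towards the value `z`, exact when taken in the chart.
  refine ⟨e.symm (w + R (z - F w)), ?_, ?_⟩
  · have h1 := hA (e.symm (w + R (z - F w)))
    rw [e.right_inv hyt, add_sub_cancel_left, hR] at h1
    exact (sub_left_injective h1).symm
  · have h1 := (hb _ (hs ▸ e.map_target hyt)).1
    rw [e.right_inv hyt, add_sub_cancel_left] at h1
    linarith

/-! ### Equivalence classes near a level set, and the quotient distance -/

/-- Reduces invariance of a quantity along a curve to a single differentiable piece; used both for
the class function and for the geodesic distance. -/
theorem PiecewiseDifferentiable.eq_of_forall_piece {W α : Type*} [NormedAddCommGroup W]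
    [NormedSpace ℝ W] {γ : ℝ → W} (hγ : PiecewiseDifferentiable γ) {φ : ℝ → α}
    (h : ∀ a b, 0 ≤ a → a ≤ b → b ≤ 1 → DifferentiableOn ℝ γ (Icc a b) → φ a = φ b) :
    φ 0 = φ 1 := by
  obtain ⟨k, t, h0, h1, hlt, hd⟩ := hγ
  have hmono : ∀ i j, i ≤ j → j ≤ k → t i ≤ t j := by
    intro i j hij
    induction hij with
    | refl => intro _; exact le_rfl
    | step _ ih => intro hj; exact (ih (by omega)).trans (hlt _ (by omega)).le
  have key : ∀ i, i ≤ k → φ 0 = φ (t i) := by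
    intro i
    induction i with
    | zero => intro _; rw [h0]
    | succ j ih =>
      intro hj
      rw [ih (by omega)]
      exact h _ _ (h0 ▸ hmono 0 j (by omega) (by omega)) (hlt j (by omega)).le
        (h1 ▸ hmono (j + 1) k hj le_rfl) (hd j (by omega))
  rw [key k le_rfl, h1]

theorem effClass_eq_iff {W U V : Type*} [NormedAddCommGroup W] [NormedSpace ℝ W]
    {f : W → U → V} {X : Set U} {w w' : W} :
    effClass f X w = effClass f X w' ↔ w' ∈ smoothReparams f X w :=
  Quotient.eq (r := reparamSetoid f X)

theorem map_eq_of_effClass_eq {E V U V' : Type*} [NormedAddCommGroup E]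
    [NormedSpace ℝ E] {F : E → V} {f : E → U → V'} {X : Set U}
    (hX : ∀ w w', w' ∈ setReparams f X w ↔ F w' = F w)
    {w w' : E} (h : effClass f X w = effClass f X w') : F w' = F w := by
  obtain ⟨γ, -, -, rfl, h2⟩ := effClass_eq_iff.1 h
  exact (hX _ _).1 (h2 1 (right_mem_Icc.2 zero_le_one))

section FiberClass

variable {E V U V' : Type*} [NormedAddCommGroup E] [NormedSpace ℝ E]
  [NormedAddCommGroup V] [NormedSpace ℝ V] {F : E → V}
  {f : E → U → V'} {X : Set U}

/-- Where the derivative of `F` has bounded right inverses, the equivalence class of a point of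
the level set of `z` extends to a locally constant function. -/
theorem exists_locally_constant_class [CompleteSpace E] (hF : Differentiable ℝ F) {K : ℝ≥0}
    (hK : LipschitzWith K (fderiv ℝ F))
    (hX : ∀ w w', w' ∈ setReparams f X w ↔ F w' = F w) {z : V} {ρ M : ℝ} (hρ : 0 < ρ)
    (hinv : ∀ w, ‖F w - z‖ < ρ → ∃ R : V →L[ℝ] E, (∀ v, fderiv ℝ F w (R v) = v) ∧ ‖R‖ ≤ M) :
    ∃ ρ' > 0, ρ' ≤ ρ ∧ ∃ δ > 0, ∃ c : E → EffectiveParams f X,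
      (∀ w, F w = z → c w = effClass f X w) ∧
      ∀ w w', ‖F w - z‖ < ρ' → ‖F w' - z‖ < ρ' → ‖w - w'‖ < δ → c w = c w' := by
  classical
  -- A positive replacement for `M`, whose sign is not known; likewise `K + 1` below avoids dividing
  -- by zero.
  set m : ℝ := |M| + 1 with hm
  have hm0 : 0 < m := by positivity
  have hMm : M ≤ m := (le_abs_self M).trans (by linarith)
  have hK0 : (0 : ℝ) < K + 1 := by positivity
  set r : ℝ := 1 / (2 * m * (K + 1)) with hrdef
  have hr : 0 < r := by positivity
  have hmr : m * K * r ≤ 1 / 2 := by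
    rw [hrdef, mul_one_div, div_le_iff₀ (by positivity)]
    linarith
  -- Moving each of `w`, `w'` to the fibre costs less than `2 * m * r / (32 * m) = r / 16`. With `δ
  -- = r / 8` the two fibre points are then closer than `r / 4`, as `exists_curve_in_fiber`
  -- requires.
  refine ⟨min ρ (r / (32 * m)), lt_min hρ (by positivity), min_le_left _ _, r / 8, by positivity,
    ?_⟩
  have hex : ∀ w, ‖F w - z‖ < min ρ (r / (32 * m)) →
      ∃ u, F u = z ∧ ‖u - w‖ ≤ 2 * m * ‖F w - z‖ := by
    intro w hw
    obtain ⟨R, hR, hRM⟩ := hinv w (hw.trans_le (min_le_left _ _))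
    refine exists_near_mem_fiber hF hK hr hmr hR (hRM.trans hMm) ?_
    have h1 := (lt_div_iff₀ (by positivity)).1 (hw.trans_le (min_le_right _ _))
    nlinarith
  let u : E → E := fun w => if h : ∃ u, F u = z ∧ ‖u - w‖ ≤ 2 * m * ‖F w - z‖ then h.choose else w
  have hu : ∀ w, ‖F w - z‖ < min ρ (r / (32 * m)) →
      F (u w) = z ∧ ‖u w - w‖ ≤ 2 * m * ‖F w - z‖ := by
    intro w hw
    have h := hex w hw
    simp only [u, dif_pos h]
    exact h.choose_spec
  refine ⟨fun w => effClass f X (u w), fun w hw => ?_, fun w w' hw hw' hww' => ?_⟩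
  -- On the fibre itself the distance bound is zero, which forces `u w = w`.
  · have h := (hu w (by simp [hw]; exact ⟨hρ, by positivity⟩)).2
    rw [hw, sub_self, norm_zero, mul_zero, norm_le_zero_iff, sub_eq_zero] at h
    simp only [h]
  · obtain ⟨h1, h2⟩ := hu w hw
    obtain ⟨h1', h2'⟩ := hu w' hw'
    obtain ⟨R, hR, hRM⟩ := hinv (u w) (by rw [h1]; simpa using hρ)
    have e1 := (lt_div_iff₀ (by positivity)).1 (hw.trans_le (min_le_right _ _))
    have e2 := (lt_div_iff₀ (by positivity)).1 (hw'.trans_le (min_le_right _ _))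
    have hd : ‖u w' - u w‖ < r / 4 := by
      have : u w' - u w = (u w' - w') - (w - w') - (u w - w) := by abel
      rw [this]
      have t1 := norm_sub_le (u w' - w' - (w - w')) (u w - w)
      have t2 := norm_sub_le (u w' - w') (w - w')
      linarith
    obtain ⟨γ, hγ, g0, g1, hγF⟩ := exists_curve_in_fiber hF hK hr hmr hR (hRM.trans hMm)
      (h1'.trans h1.symm) hd
    exact effClass_eq_iff.2 ⟨γ, hγ, g0, g1, fun t ht => (hX _ _).2 (hγF t ht)⟩

/-- A locally constant function is constant along a continuous curve. -/
theorem eq_of_continuousOn_of_locally_constant {E α : Type*} [SeminormedAddCommGroup E]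
    {S : Set E} {c : E → α} {δ : ℝ}
    (hδ : 0 < δ) (hc : ∀ w ∈ S, ∀ w' ∈ S, ‖w - w'‖ < δ → c w = c w')
    {γ : ℝ → E} {a b : ℝ} (hab : a ≤ b) (hγ : ContinuousOn γ (Icc a b))
    (hS : ∀ t ∈ Icc a b, γ t ∈ S) : c (γ a) = c (γ b) := by
  refine isPreconnected_Icc.induction₂ (fun s t => c (γ s) = c (γ t)) ?_
    (fun _ _ _ _ _ _ h1 h2 => h1.trans h2) (fun _ _ _ _ h => h.symm)
    (left_mem_Icc.2 hab) (right_mem_Icc.2 hab)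
  intro t ht
  have h1 := Metric.tendsto_nhds.1 (hγ t ht) δ hδ
  filter_upwards [h1, self_mem_nhdsWithin] with s hs hs'
  exact hc _ (hS t ht) _ (hS s hs') (by rwa [dist_comm, dist_eq_norm] at hs)

theorem norm_sub_le_of_lipschitz_fderiv (hF : Differentiable ℝ F) {K : ℝ≥0}
    (hK : LipschitzWith K (fderiv ℝ F)) (w u : E) :
    ‖F u - F w - fderiv ℝ F w (u - w)‖ ≤ K * ‖u - w‖ ^ 2 := by
  have h := (convex_closedBall w ‖u - w‖).norm_image_sub_le_of_norm_hasFDerivWithin_le'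
    (f := F) (f' := fderiv ℝ F) (φ := fderiv ℝ F w) (C := K * ‖u - w‖) (x := w) (y := u)
    (fun z _ => (hF z).hasFDerivAt.hasFDerivWithinAt) (fun z hz => ?_)
    (by simp) (by simp [dist_eq_norm])
  · calc _ ≤ _ := h
      _ = _ := by ring
  · have h1 := hK.dist_le_mul z w
    rw [dist_eq_norm] at h1
    exact h1.trans (mul_le_mul_of_nonneg_left hz K.2)

/-- Moving within a class leaves `F` unchanged, and a jump from `p` to `q` changes it by at most `C
* ‖p - q‖`, so a short chain stays in the tube. The function `c` survives both kinds of move. -/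
theorem effClass_eq_of_quotientDist_eq_zero [CompleteSpace E] (hF : Differentiable ℝ F) {K : ℝ≥0}
    (hK : LipschitzWith K (fderiv ℝ F))
    (hX : ∀ w w', w' ∈ setReparams f X w ↔ F w' = F w) {w₀ w₁ : E} {ρ M : ℝ} (hρ : 0 < ρ)
    (hinv : ∀ w, ‖F w - F w₀‖ < ρ →
      ∃ R : V →L[ℝ] E, (∀ v, fderiv ℝ F w (R v) = v) ∧ ‖R‖ ≤ M)
    (hbd : ∀ w, ‖F w - F w₀‖ < ρ → ‖fderiv ℝ F w‖ ≤ M)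
    (hd : quotientDist f X (effClass f X w₀) (effClass f X w₁) = 0) :
    effClass f X w₀ = effClass f X w₁ := by
  obtain ⟨ρ', hρ', hρρ', δ, hδ, c, hc0, hc⟩ := exists_locally_constant_class hF hK hX hρ hinv
  -- Off the fibre of `F w₀`, `c` is not the class of its argument. It still respects equivalence,
  -- because the joining curve keeps `F` constant and hence remains in the tube.
  have hcl : ∀ a b, ‖F a - F w₀‖ < ρ' → effClass f X a = effClass f X b → c a = c b := by
    intro a b ha hab
    obtain ⟨γ, hγ, rfl, rfl, hγF⟩ := effClass_eq_iff.1 hab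
    refine hγ.eq_of_forall_piece (φ := fun t => c (γ t)) fun s t hs hst ht hdiff => ?_
    refine eq_of_continuousOn_of_locally_constant (S := {w | ‖F w - F w₀‖ < ρ'}) hδ
      (fun w hw w' hw' => hc w w' hw hw') hst hdiff.continuousOn fun s' hs' => ?_
    have := (hX _ _).1 (hγF s' ⟨hs.trans hs'.1, hs'.2.trans ht⟩)
    simpa [this] using ha
  have hM0 : 0 ≤ M := (norm_nonneg _).trans (hbd w₀ (by simpa using hρ))
  -- `M` bounds the linear part of a jump, `K` the quadratic remainder for jumps of length at most
  -- 1, and 1 ensures positivity.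
  set C : ℝ := M + K + 1 with hC
  have hC0 : 0 < C := by positivity
  have hjump : ∀ p q, ‖F p - F w₀‖ < ρ' → ‖p - q‖ ≤ 1 → ‖F q - F w₀‖ ≤ ‖F p - F w₀‖ +
      C * ‖p - q‖ := by
    intro p q hp hpq
    have h1 := norm_sub_le_of_lipschitz_fderiv hF hK p q
    have h2 := (fderiv ℝ F p).le_of_opNorm_le (hbd p (hp.trans_le hρρ')) (q - p)
    rw [norm_sub_rev q p] at h1 h2
    have h3 : F q - F w₀ = (F p - F w₀) + (F q - F p - fderiv ℝ F p (q - p)) +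
      fderiv ℝ F p (q - p) := by abel
    have h4 := norm_add₃_le (a := F p - F w₀) (b := F q - F p - fderiv ℝ F p (q - p))
      (c := fderiv ℝ F p (q - p))
    rw [← h3] at h4
    have h5 : (K : ℝ) * ‖p - q‖ ^ 2 ≤ K * ‖p - q‖ :=
      mul_le_mul_of_nonneg_left (by nlinarith [norm_nonneg (p - q)]) K.2
    have h6 : C * ‖p - q‖ = M * ‖p - q‖ + K * ‖p - q‖ + ‖p - q‖ := by rw [hC]; ring
    linarith [norm_nonneg (p - q)]
  -- The start `a` is arbitrary so that the induction can restart at `q 0`, with the drift of `F` so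
  -- far absorbed into `‖F a - F w₀‖`.
  have hchain : ∀ (n : ℕ) (p q : Fin (n + 1) → E) (a b : E),
      effClass f X a = effClass f X (p 0) →
      (∀ i : Fin n, effClass f X (p i.succ) = effClass f X (q i.castSucc)) →
      effClass f X (q (Fin.last n)) = effClass f X b →
      ‖F a - F w₀‖ + C * ∑ i, ‖p i - q i‖ < ρ' → (∑ i, ‖p i - q i‖) < δ →
      (∑ i, ‖p i - q i‖) ≤ 1 →
      c a = c b ∧ ‖F b - F w₀‖ ≤ ‖F a - F w₀‖ + C * ∑ i, ‖p i - q i‖ := by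
    have hstep : ∀ a p q : E, effClass f X a = effClass f X p →
        ‖F a - F w₀‖ + C * ‖p - q‖ < ρ' → ‖p - q‖ < δ → ‖p - q‖ ≤ 1 →
        c a = c q ∧ ‖F q - F w₀‖ ≤ ‖F a - F w₀‖ + C * ‖p - q‖ := by
      intro a p q hap h1 h2 h3
      have hFp := map_eq_of_effClass_eq hX hap
      have h0 : 0 ≤ C * ‖p - q‖ := by positivity
      have hq := hjump p q (by rw [hFp]; linarith) h3
      rw [hFp] at hq
      exact ⟨(hcl a p (by linarith) hap).trans
        (hc p q (by rw [hFp]; linarith) (by linarith) h2), hq⟩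
    intro n
    induction n with
    | zero =>
      intro p q a b hap _ hqb h1 h2 h3
      simp only [Fin.sum_univ_succ, Fin.sum_univ_zero, add_zero] at h1 h2 h3 ⊢
      obtain ⟨e1, e2⟩ := hstep a (p 0) (q 0) hap h1 h2 h3
      rw [map_eq_of_effClass_eq hX hqb]
      exact ⟨e1.trans (hcl _ _ (by linarith) hqb), e2⟩
    | succ n ih =>
      intro p q a b hap hpq hqb h1 h2 h3
      rw [Fin.sum_univ_succ] at h1 h2 h3 ⊢
      have hs : 0 ≤ ∑ i : Fin (n + 1), ‖p i.succ - q i.succ‖ :=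
        Finset.sum_nonneg fun _ _ => norm_nonneg _
      have hs' : 0 ≤ C * ∑ i : Fin (n + 1), ‖p i.succ - q i.succ‖ := mul_nonneg hC0.le hs
      have hn := norm_nonneg (p 0 - q 0)
      rw [mul_add] at h1 ⊢
      obtain ⟨e1, e2⟩ := hstep a (p 0) (q 0) hap (by linarith) (by linarith) (by linarith)
      obtain ⟨e3, e4⟩ := ih (fun i => p i.succ) (fun i => q i.succ) (q 0) b
        (hpq 0).symm (fun i => hpq i.succ) hqb (by linarith) (by linarith) (by linarith)
      exact ⟨e1.trans e3, by linarith⟩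
  have hsmall : ∀ ε > 0, ε ≤ ρ' / C → ε ≤ δ → ε ≤ 1 →
      c w₀ = c w₁ ∧ ‖F w₁ - F w₀‖ ≤ C * ε := by
    intro ε hε h1 h2 h3
    have hne : {r : ℝ | ∃ (n : ℕ) (p q : Fin (n + 1) → E),
        effClass f X w₀ = effClass f X (p 0) ∧
        (∀ i : Fin n, effClass f X (p i.succ) = effClass f X (q i.castSucc)) ∧
        effClass f X (q (Fin.last n)) = effClass f X w₁ ∧
        r = ∑ i, ‖p i - q i‖}.Nonempty :=
      ⟨_, 0, fun _ => w₀, fun _ => w₁, rfl, fun i => i.elim0, rfl, rfl⟩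
    obtain ⟨r, ⟨n, p, q, hp, hpq, hq, rfl⟩, hr⟩ := exists_lt_of_csInf_lt hne (hd.trans_lt hε)
    have hCr : C * ∑ i, ‖p i - q i‖ < C * ε := mul_lt_mul_of_pos_left hr hC0
    have hCε : C * ε ≤ ρ' := by rw [mul_comm]; exact (le_div_iff₀ hC0).1 h1
    obtain ⟨e1, e2⟩ := hchain n p q w₀ w₁ hp hpq hq (by simp; linarith) (by linarith) (by linarith)
    refine ⟨e1, e2.trans ?_⟩
    simp only [sub_self, norm_zero, zero_add]
    exact hCr.le
  set ε₀ := min (ρ' / C) (min δ 1) with hε₀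
  have hε₀0 : 0 < ε₀ := lt_min (by positivity) (lt_min hδ one_pos)
  have h1 : ε₀ ≤ ρ' / C := min_le_left _ _
  have h2 : ε₀ ≤ δ := (min_le_right _ _).trans (min_le_left _ _)
  have h3 : ε₀ ≤ 1 := (min_le_right _ _).trans (min_le_right _ _)
  have hFw : F w₁ = F w₀ := by
    by_contra hne
    have hpos : 0 < ‖F w₁ - F w₀‖ := norm_pos_iff.2 (sub_ne_zero.2 hne)
    -- With this `ε`, `hsmall` bounds `‖F w₁ - F w₀‖` by half of itself.
    set ε := min ε₀ (‖F w₁ - F w₀‖ / (2 * C))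
    have hle : ε ≤ ε₀ := min_le_left _ _
    have hle' : ε * (2 * C) ≤ ‖F w₁ - F w₀‖ :=
      (le_div_iff₀ (by positivity)).1 (min_le_right _ _)
    have := (hsmall ε (lt_min hε₀0 (by positivity)) (by linarith) (by linarith) (by linarith)).2
    linarith
  rw [← hc0 w₀ rfl, ← hc0 w₁ hFw]
  exact (hsmall ε₀ hε₀0 h1 h2 h3).1

theorem quotientDist_self (a : E) : quotientDist f X (effClass f X a) (effClass f X a) = 0 := by
  refine le_antisymm (csInf_le ⟨0, ?_⟩ ?_) (Real.sInf_nonneg ?_)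
  · rintro _ ⟨n, p, q, -, -, -, rfl⟩
    exact Finset.sum_nonneg fun _ _ => norm_nonneg _
  · exact ⟨0, fun _ => a, fun _ => a, rfl, fun i => i.elim0, rfl, by simp⟩
  · rintro _ ⟨n, p, q, -, -, -, rfl⟩
    exact Finset.sum_nonneg fun _ _ => norm_nonneg _

end FiberClass

/-! ### Lengths of curves and the triangle inequality -/

/-- The speed of a curve on `[0,1]` with respect to a field of quadratic forms. -/
noncomputable def metricSpeed {D : ℕ}
    (g : EuclideanSpace ℝ (Fin D) → Matrix (Fin D) (Fin D) ℝ)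
    (γ : ℝ → EuclideanSpace ℝ (Fin D)) (t : ℝ) : ℝ :=
  √((derivWithin γ (Icc 0 1) t).ofLp ⬝ᵥ (g (γ t) *ᵥ (derivWithin γ (Icc 0 1) t).ofLp))

section GeodesicDist

variable {D : ℕ} {g : EuclideanSpace ℝ (Fin D) → Matrix (Fin D) (Fin D) ℝ}
  {γ : ℝ → EuclideanSpace ℝ (Fin D)} {u v w : EuclideanSpace ℝ (Fin D)}

theorem metricLength_nonneg (g : EuclideanSpace ℝ (Fin D) → Matrix (Fin D) (Fin D) ℝ)
    (γ : ℝ → EuclideanSpace ℝ (Fin D)) : 0 ≤ metricLength g γ :=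
  intervalIntegral.integral_nonneg zero_le_one fun _ _ => Real.sqrt_nonneg _

theorem continuousOn_metricSpeed (hg : Continuous g) (hγ : ContDiffOn ℝ ∞ γ (Icc 0 1)) :
    ContinuousOn (metricSpeed g γ) (Icc 0 1) := by
  have h1 : ContinuousOn (derivWithin γ (Icc 0 1)) (Icc 0 1) :=
    hγ.continuousOn_derivWithin (uniqueDiffOn_Icc zero_lt_one) (by simp)
  have h2 : ContinuousOn (fun t => g (γ t)) (Icc 0 1) := hg.comp_continuousOn hγ.continuousOn
  have h3 : ContinuousOn (fun t => (derivWithin γ (Icc 0 1) t).ofLp) (Icc 0 1) :=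
    (PiLp.continuous_ofLp 2 _).comp_continuousOn h1
  rw [continuousOn_iff_continuous_domRestrict] at h2 h3 ⊢
  exact (h3.dotProduct (h2.matrix_mulVec h3)).sqrt

theorem metricGeodesicDist_nonneg (g : EuclideanSpace ℝ (Fin D) → Matrix (Fin D) (Fin D) ℝ)
    (u v : EuclideanSpace ℝ (Fin D)) : 0 ≤ metricGeodesicDist g u v := by
  refine Real.sInf_nonneg ?_
  rintro _ ⟨γ, -, -, -, rfl⟩
  exact metricLength_nonneg g γ

theorem metricGeodesicDist_le (hγ : ContDiffOn ℝ ∞ γ (Icc 0 1)) (h0 : γ 0 = u) (h1 : γ 1 = v) :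
    metricGeodesicDist g u v ≤ metricLength g γ := by
  refine csInf_le ⟨0, ?_⟩ ⟨γ, hγ, h0, h1, rfl⟩
  rintro _ ⟨γ, -, -, -, rfl⟩
  exact metricLength_nonneg g γ

theorem nonempty_metricLengths (g : EuclideanSpace ℝ (Fin D) → Matrix (Fin D) (Fin D) ℝ)
    (u v : EuclideanSpace ℝ (Fin D)) : {r : ℝ | ∃ γ : ℝ → EuclideanSpace ℝ (Fin D),
      ContDiffOn ℝ ∞ γ (Icc 0 1) ∧ γ 0 = u ∧ γ 1 = v ∧ r = metricLength g γ}.Nonempty :=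
  ⟨_, fun t => u + t • (v - u), by fun_prop, by simp, by simp, rfl⟩

/-- Lengths are invariant under monotone reparametrization. -/
theorem integral_metricSpeed_of_eventuallyEq {η : ℝ → EuclideanSpace ℝ (Fin D)} {s : ℝ → ℝ}
    {a b : ℝ} (hab : a ≤ b) (ha : 0 ≤ a) (hb : b ≤ 1) (hγ : ContDiffOn ℝ ∞ γ (Icc 0 1))
    (hs : Differentiable ℝ s) (hmono : Monotone s) (hmem : ∀ t, s t ∈ Icc (0 : ℝ) 1)
    (hsa : s a = 0) (hsb : s b = 1) (hη : ∀ t ∈ Ioo a b, η =ᶠ[nhds t] γ ∘ s) :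
    ∫ t in a..b, metricSpeed g η t = metricLength g γ := by
  have h1 : ∫ t in a..b, metricSpeed g η t =
      ∫ t in a..b, (metricSpeed g γ ∘ s) t * deriv s t := by
    refine intervalIntegral.integral_congr_Ioo_of_le hab fun t ht => ?_
    have hγt : HasDerivWithinAt γ (derivWithin γ (Icc 0 1) (s t)) (Icc 0 1) (s t) :=
      ((hγ.differentiableOn (by simp)) _ (hmem t)).hasDerivWithinAt
    have hd : HasDerivAt η (deriv s t • derivWithin γ (Icc 0 1) (s t)) t :=
      (hγt.scomp_hasDerivAt t (hs t).hasDerivAt hmem).congr_of_eventuallyEq (hη t ht)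
    have htI : t ∈ Icc (0 : ℝ) 1 := ⟨ha.trans ht.1.le, ht.2.le.trans hb⟩
    have hd' := hd.hasDerivWithinAt.derivWithin (uniqueDiffOn_Icc zero_lt_one t htI)
    have hs0 : 0 ≤ deriv s t := hmono.deriv_nonneg
    have hηt : η t = γ (s t) := (hη t ht).eq_of_nhds
    simp only [metricSpeed, Function.comp_apply, hd', hηt, WithLp.ofLp_smul, Matrix.mulVec_smul,
      smul_dotProduct, dotProduct_smul, smul_eq_mul]
    rw [← mul_assoc, Real.sqrt_mul (mul_self_nonneg _), Real.sqrt_mul_self hs0, mul_comm]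
  rw [h1, intervalIntegral.integral_comp_mul_deriv_of_deriv_nonneg hs.continuous.continuousOn
    (fun t _ => (hs t).hasDerivAt) (fun t _ => hmono.deriv_nonneg), hsa, hsb]
  rfl

/-- A concatenation of smooth curves may have a corner. Slowing each down by `Real.smoothTransition`
removes it: `α ∘ a + β ∘ b - v` is smooth as a single formula, one of its terms resting at `v` while
the other moves. -/
theorem metricGeodesicDist_triangle (hg : Continuous g) (u v w : EuclideanSpace ℝ (Fin D)) :
    metricGeodesicDist g u w ≤ metricGeodesicDist g u v + metricGeodesicDist g v w := by
  rw [← sub_le_iff_le_add]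
  refine le_csInf (nonempty_metricLengths g u v) ?_
  rintro _ ⟨α, hα, α0, α1, rfl⟩
  rw [sub_le_comm]
  refine le_csInf (nonempty_metricLengths g v w) ?_
  rintro _ ⟨β, hβ, β0, β1, rfl⟩
  rw [sub_le_iff_le_add']
  let σ := Real.smoothTransition
  have hσ : ContDiff ℝ ∞ σ := Real.smoothTransition.contDiff
  have hσm : ∀ t, σ t ∈ Icc (0 : ℝ) 1 :=
    fun t => ⟨Real.smoothTransition.nonneg t, Real.smoothTransition.le_one t⟩
  let a : ℝ → ℝ := fun t => σ (2 * t)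
  let b : ℝ → ℝ := fun t => σ (2 * t - 1)
  have ha : ContDiff ℝ ∞ a := hσ.comp (by fun_prop)
  have hb : ContDiff ℝ ∞ b := hσ.comp (by fun_prop)
  have ham : Monotone a := fun s t h => Real.smoothTransition.monotone (by linarith)
  have hbm : Monotone b := fun s t h => Real.smoothTransition.monotone (by linarith)
  let η : ℝ → EuclideanSpace ℝ (Fin D) := fun t => α (a t) + β (b t) - v
  have hη : ContDiffOn ℝ ∞ η (Icc 0 1) :=
    ((hα.comp ha.contDiffOn fun t _ => hσm _).add
      (hβ.comp hb.contDiffOn fun t _ => hσm _)).sub contDiffOn_const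
  have a1 : ∀ t, 1 / 2 ≤ t → a t = 1 :=
    fun t ht => Real.smoothTransition.one_of_one_le (by linarith)
  have b0 : ∀ t, t ≤ 1 / 2 → b t = 0 :=
    fun t ht => Real.smoothTransition.zero_of_nonpos (by linarith)
  have a0 : a 0 = 0 := Real.smoothTransition.zero_of_nonpos (by simp)
  have b1 : b 1 = 1 := Real.smoothTransition.one_of_one_le (by norm_num)
  have hη1 : ∀ t, t ≤ 1 / 2 → η t = α (a t) := fun t ht => by simp [η, b0 t ht, β0]
  have hη2 : ∀ t, 1 / 2 ≤ t → η t = β (b t) := fun t ht => by simp [η, a1 t ht, α1]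
  refine (metricGeodesicDist_le (g := g) hη (by rw [hη1 0 (by norm_num), a0, α0])
    (by rw [hη2 1 (by norm_num), b1, β1])).trans_eq ?_
  have hint : ∀ c d : ℝ, 0 ≤ c → c ≤ d → d ≤ 1 →
      IntervalIntegrable (metricSpeed g η) MeasureTheory.volume c d := by
    intro c d hc hcd hd
    refine ContinuousOn.intervalIntegrable_of_Icc hcd ?_
    exact (continuousOn_metricSpeed hg hη).mono (Icc_subset_Icc hc hd)
  have hsplit := intervalIntegral.integral_add_adjacent_intervals
    (hint 0 (1 / 2) le_rfl (by norm_num) (by norm_num))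
    (hint (1 / 2) 1 (by norm_num) (by norm_num) le_rfl)
  rw [integral_metricSpeed_of_eventuallyEq (by norm_num) le_rfl (by norm_num) hα
      (ha.differentiable (by simp)) ham (fun t => hσm _) a0 (a1 _ le_rfl)
      (fun t ht => by filter_upwards [Iio_mem_nhds ht.2] with s hs using hη1 s (le_of_lt hs)),
    integral_metricSpeed_of_eventuallyEq (by norm_num) (by norm_num) le_rfl hβ
      (hb.differentiable (by simp)) hbm (fun t => hσm _) (b0 _ le_rfl) b1
      (fun t ht => by filter_upwards [Ioi_mem_nhds ht.1] with s hs using hη2 s (le_of_lt hs))]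
    at hsplit
  exact hsplit.symm

theorem metricGeodesicDist_le_of_segment {C : ℝ}
    (hC : ∀ t ∈ Icc (0 : ℝ) 1,
      √((v - u).ofLp ⬝ᵥ (g (u + t • (v - u)) *ᵥ (v - u).ofLp)) ≤ C) :
    metricGeodesicDist g u v ≤ C := by
  refine (metricGeodesicDist_le (γ := fun t : ℝ => u + t • (v - u)) (by fun_prop) (by simp)
    (by simp)).trans ?_
  refine (le_abs_self _).trans ?_
  have h := intervalIntegral.norm_integral_le_of_norm_le_const (a := 0) (b := 1) (C := C)
    (f := metricSpeed g fun t : ℝ => u + t • (v - u)) ?_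
  · simpa using! h
  · intro t ht
    rw [uIoc_of_le zero_le_one] at ht
    have htI : t ∈ Icc (0 : ℝ) 1 := ⟨ht.1.le, ht.2⟩
    have hd : HasDerivAt (fun t : ℝ => u + t • (v - u)) (v - u) t := by
      simpa using ((hasDerivAt_id t).smul_const (v - u)).const_add u
    rw [metricSpeed, hd.hasDerivWithinAt.derivWithin (uniqueDiffOn_Icc zero_lt_one t htI),
      Real.norm_of_nonneg (Real.sqrt_nonneg _)]
    exact hC t htI

/-! ### Geodesic distance and level sets -/

variable {V U V' : Type*} [NormedAddCommGroup V] [NormedSpace ℝ V]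
  {F : EuclideanSpace ℝ (Fin D) → V} {f : EuclideanSpace ℝ (Fin D) → U → V'} {X : Set U}
  {K : ℝ≥0}

/-- The competitor is the straight segment. As `F v = F u`, Taylor's formula makes `DF(u) h`
quadratic in `h = v - u`, and the Lipschitz bound carries this to the whole segment. The smallness
hypothesis keeps the segment in the tube where `hspeed` applies. -/
theorem metricGeodesicDist_le_sq_of_map_eq (hF : Differentiable ℝ F)
    (hK : LipschitzWith K (fderiv ℝ F)) {ρ M : ℝ} (hM : 0 ≤ M)
    (hspeed : ∀ w, ‖F w - F u‖ < ρ → ∀ h : EuclideanSpace ℝ (Fin D),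
      √(h.ofLp ⬝ᵥ (g w *ᵥ h.ofLp)) ≤ M * ‖fderiv ℝ F w h‖)
    (huv : F v = F u) (hsmall : 2 * K * ‖v - u‖ ^ 2 < ρ) :
    metricGeodesicDist g u v ≤ M * (2 * K * ‖v - u‖ ^ 2) := by
  refine metricGeodesicDist_le_of_segment fun t ht => ?_
  set h := v - u with hh
  have h1 : ‖fderiv ℝ F u h‖ ≤ K * ‖h‖ ^ 2 := by
    have := norm_sub_le_of_lipschitz_fderiv hF hK u v
    rwa [huv, sub_self, zero_sub, norm_neg, ← hh] at this
  have hth : ‖t • h‖ ≤ ‖h‖ := by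
    rw [norm_smul, Real.norm_of_nonneg ht.1]
    exact mul_le_of_le_one_left (norm_nonneg _) ht.2
  have h2 : ‖fderiv ℝ F (u + t • h) h‖ ≤ 2 * K * ‖h‖ ^ 2 := by
    have e1 := hK.dist_le_mul (u + t • h) u
    rw [dist_eq_norm, dist_eq_norm, add_sub_cancel_left] at e1
    have e2 := ((fderiv ℝ F (u + t • h) - fderiv ℝ F u).le_of_opNorm_le e1 h).trans
      (mul_le_mul_of_nonneg_right (mul_le_mul_of_nonneg_left hth K.2) (norm_nonneg h))
    have e3 := norm_add_le ((fderiv ℝ F (u + t • h) - fderiv ℝ F u) h) (fderiv ℝ F u h)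
    rw [sub_apply, sub_add_cancel] at e3
    rw [sub_apply] at e2
    have e4 : (K : ℝ) * ‖h‖ * ‖h‖ = K * ‖h‖ ^ 2 := by ring
    change _ ≤ (K : ℝ) * ‖h‖ * ‖h‖ at e2
    linarith
  have h3 : ‖F (u + t • h) - F u‖ < ρ := by
    have e1 := norm_sub_le_of_lipschitz_fderiv hF hK u (u + t • h)
    rw [add_sub_cancel_left, map_smul] at e1
    have e2 : (K : ℝ) * ‖t • h‖ ^ 2 ≤ K * ‖h‖ ^ 2 :=
      mul_le_mul_of_nonneg_left (pow_le_pow_left₀ (norm_nonneg _) hth 2) K.2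
    have e3 : ‖t • fderiv ℝ F u h‖ ≤ K * ‖h‖ ^ 2 := by
      rw [norm_smul, Real.norm_of_nonneg ht.1]
      exact (mul_le_of_le_one_left (norm_nonneg _) ht.2).trans h1
    have e4 := norm_add_le (F (u + t • h) - F u - t • fderiv ℝ F u h) (t • fderiv ℝ F u h)
    rw [sub_add_cancel] at e4
    linarith
  exact (hspeed _ h3 h).trans (mul_le_mul_of_nonneg_left h2 hM)

theorem metricGeodesicDist_self (u : EuclideanSpace ℝ (Fin D)) :
    metricGeodesicDist g u u = 0 :=
  le_antisymm (metricGeodesicDist_le_of_segment fun t _ => by simp)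
    (metricGeodesicDist_nonneg g u u)

/-- Along a differentiable curve in a level set of `F` the distance to the starting point has
vanishing derivative, hence vanishes. -/
theorem metricGeodesicDist_eq_zero_of_effClass_eq (hg : Continuous g) (hF : Differentiable ℝ F)
    (hK : LipschitzWith K (fderiv ℝ F))
    (hX : ∀ w w', w' ∈ setReparams f X w ↔ F w' = F w) {w₀ w₁ : EuclideanSpace ℝ (Fin D)}
    {ρ M : ℝ} (hρ : 0 < ρ) (hM : 0 ≤ M)
    (hspeed : ∀ w, ‖F w - F w₀‖ < ρ → ∀ h : EuclideanSpace ℝ (Fin D),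
      √(h.ofLp ⬝ᵥ (g w *ᵥ h.ofLp)) ≤ M * ‖fderiv ℝ F w h‖)
    (h : effClass f X w₀ = effClass f X w₁) : metricGeodesicDist g w₀ w₁ = 0 := by
  obtain ⟨γ, hγ, rfl, rfl, hγF⟩ := effClass_eq_iff.1 h
  have hγF' : ∀ t ∈ Icc (0 : ℝ) 1, F (γ t) = F (γ 0) := fun t ht => (hX _ _).1 (hγF t ht)
  refine Eq.trans ?_ (metricGeodesicDist_self (g := g) (γ 0))
  symm
  refine hγ.eq_of_forall_piece (φ := fun t => metricGeodesicDist g (γ 0) (γ t))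
    fun a b ha hab hb hd => ?_
  set φ : ℝ → ℝ := fun t => metricGeodesicDist g (γ 0) (γ t) with hφ
  have hder : ∀ t ∈ Icc a b, HasDerivWithinAt φ 0 (Icc a b) t := by
    intro t ht
    have htI : t ∈ Icc (0 : ℝ) 1 := ⟨ha.trans ht.1, ht.2.trans hb⟩
    rw [hasDerivWithinAt_iff_isLittleO]
    have hO : (fun s => γ s - γ t) =O[nhdsWithin t (Icc a b)] fun s => s - t :=
      (hd t ht).isBigO_sub
    have ht0 : Filter.Tendsto (fun s => γ s - γ t) (nhdsWithin t (Icc a b)) (nhds 0) := by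
      simpa using ((hd t ht).continuousWithinAt.tendsto.sub_const (γ t))
    have hO2 : (fun s => ‖γ s - γ t‖ ^ 2) =o[nhdsWithin t (Icc a b)] fun s => s - t := by
      have h1 : (fun s => ‖γ s - γ t‖) =o[nhdsWithin t (Icc a b)] fun _ => (1 : ℝ) :=
        (Asymptotics.isLittleO_one_iff ℝ).2 (by simpa using ht0.norm)
      have h2 := h1.mul_isBigO hO.norm_left
      simpa [sq] using h2
    refine Asymptotics.IsBigO.trans_isLittleO ?_ hO2
    refine Asymptotics.IsBigO.of_bound (M * (2 * K)) ?_
    have hev : ∀ᶠ s in nhdsWithin t (Icc a b), 2 * K * ‖γ s - γ t‖ ^ 2 < ρ := by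
      have h1 : Filter.Tendsto (fun s => 2 * (K : ℝ) * ‖γ s - γ t‖ ^ 2)
          (nhdsWithin t (Icc a b)) (nhds 0) := by
        simpa using ((ht0.norm.pow 2).const_mul (2 * (K : ℝ)))
      exact h1.eventually (Iio_mem_nhds hρ)
    filter_upwards [hev, self_mem_nhdsWithin] with s hs hsI
    have hsI' : s ∈ Icc (0 : ℝ) 1 := ⟨ha.trans hsI.1, hsI.2.trans hb⟩
    have hst : F (γ s) = F (γ t) := (hγF' s hsI').trans (hγF' t htI).symm
    -- Both orders of the pair are estimated, so symmetry of the distance is not needed.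
    have b1 := metricGeodesicDist_le_sq_of_map_eq hF hK hM
      (by rw [hγF' t htI]; exact hspeed) hst hs
    have b2 := metricGeodesicDist_le_sq_of_map_eq hF hK hM
      (by rw [hγF' s hsI']; exact hspeed) hst.symm (by rwa [norm_sub_rev])
    rw [norm_sub_rev (γ t)] at b2
    have c1 := metricGeodesicDist_triangle hg (γ 0) (γ t) (γ s)
    have c2 := metricGeodesicDist_triangle hg (γ 0) (γ s) (γ t)
    simp only [smul_zero, sub_zero, norm_pow, Real.norm_eq_abs, abs_norm, abs_le, hφ]
    constructor <;> linarith
  refine (constant_of_has_deriv_right_zero (fun t ht => (hder t ht).continuousWithinAt)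
    (fun t ht => ?_) b (right_mem_Icc.2 hab)).symm
  exact (hder t (Ico_subset_Icc_self ht)).mono_of_mem_nhdsWithin
    (Filter.mem_of_superset (Icc_mem_nhdsGE ht.2) (Icc_subset_Icc_left ht.1))

/-- A curve that is short for `g` does not leave a neighbourhood of a level set of `F`. -/
theorem norm_map_sub_le_of_metricLength (hg : Continuous g) (hF : Differentiable ℝ F)
    {ρ m ε : ℝ} (hm : 0 < m) (hε : 0 < ε)
    (hspeed : ∀ w, ‖F w - F (γ 0)‖ < ρ → ∀ h : EuclideanSpace ℝ (Fin D),
      ‖fderiv ℝ F w h‖ ≤ m * √(h.ofLp ⬝ᵥ (g w *ᵥ h.ofLp)))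
    (hγ : ContDiffOn ℝ ∞ γ (Icc 0 1)) (hlen : m * metricLength g γ + ε < ρ) :
    ∀ t ∈ Icc (0 : ℝ) 1, ‖F (γ t) - F (γ 0)‖ ≤ m * metricLength g γ + ε := by
  have hc := continuousOn_metricSpeed hg hγ
  have hint : ∀ t ∈ Icc (0 : ℝ) 1,
      IntervalIntegrable (metricSpeed g γ) MeasureTheory.volume 0 t := fun t ht =>
    ContinuousOn.intervalIntegrable_of_Icc ht.1 (hc.mono (Icc_subset_Icc_right ht.2))
  let P : ℝ → ℝ := fun t => ∫ s in (0 : ℝ)..t, metricSpeed g γ s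
  have hPle : ∀ t ∈ Icc (0 : ℝ) 1, P t ≤ metricLength g γ := by
    intro t ht
    have h1 := intervalIntegral.integral_add_adjacent_intervals (hint t ht)
      ((hint t ht).symm.trans (hint 1 (right_mem_Icc.2 zero_le_one)))
    have h2 : 0 ≤ ∫ s in t..1, metricSpeed g γ s :=
      intervalIntegral.integral_nonneg ht.2 fun _ _ => Real.sqrt_nonneg _
    change P t + _ = metricLength g γ at h1
    linarith
  have hnhds : ∀ t ∈ Ico (0 : ℝ) 1, Icc (0 : ℝ) 1 ∈ nhdsWithin t (Ici t) := fun t ht =>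
    Filter.mem_of_superset (Icc_mem_nhdsGE ht.2) (Icc_subset_Icc_left ht.1)
  have hPd : ∀ t ∈ Ico (0 : ℝ) 1, HasDerivWithinAt P (metricSpeed g γ t) (Ici t) t := by
    intro t ht
    have htI := Ico_subset_Icc_self ht
    have hle : nhdsWithin t (Ioi t) ≤ nhdsWithin t (Icc 0 1) :=
      nhdsWithin_le_of_mem (nhdsWithin_mono t Ioi_subset_Ici_self (hnhds t ht))
    exact intervalIntegral.integral_hasDerivWithinAt_right (hint t htI)
      ((hc.stronglyMeasurableAtFilter_nhdsWithin measurableSet_Icc t).filter_mono hle)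
      ((hc t htI).mono_left hle)
  have hPc : ContinuousOn P (Icc 0 1) := by
    have := intervalIntegral.continuousOn_primitive_interval
      (hc.integrableOn_Icc (μ := MeasureTheory.volume) |>.mono_set
        (uIcc_of_le (zero_le_one (α := ℝ))).le)
    rwa [uIcc_of_le zero_le_one] at this
  have hfd : ∀ t ∈ Icc (0 : ℝ) 1, HasDerivWithinAt (fun t => F (γ t) - F (γ 0))
      (fderiv ℝ F (γ t) (derivWithin γ (Icc 0 1) t)) (Icc 0 1) t := fun t ht =>
    ((hF (γ t)).hasFDerivAt.comp_hasDerivWithinAt t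
      (hγ.differentiableOn (by simp) t ht).hasDerivWithinAt).sub_const _
  -- `hspeed` is available only inside the tube, where the curve is not yet known to stay. This
  -- comparison principle asks for the derivative bound only at times when the norm equals the
  -- barrier `m * P t + ε * t`, which is below `ρ`; the term `ε * t` makes the inequality strict.
  have key := image_norm_le_of_norm_deriv_right_lt_deriv_boundary' (a := 0) (b := 1)
    (f := fun t => F (γ t) - F (γ 0))
    (f' := fun t => fderiv ℝ F (γ t) (derivWithin γ (Icc 0 1) t))
    (B := fun t => m * P t + ε * t) (B' := fun t => m * metricSpeed g γ t + ε)
    (fun t ht => (hfd t ht).continuousWithinAt)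
    (fun t ht => (hfd t (Ico_subset_Icc_self ht)).mono_of_mem_nhdsWithin (hnhds t ht))
    (by simp [P]) (by fun_prop)
    (fun t ht => by
      simpa using! ((hPd t ht).const_mul m).add ((hasDerivWithinAt_id t (Ici t)).const_mul ε))
    (fun t ht hB => by
      have h1 := hPle t (Ico_subset_Icc_self ht)
      have h2 := mul_le_mul_of_nonneg_left h1 hm.le
      have h3 : ε * t ≤ ε := mul_le_of_le_one_right hε.le ht.2.le
      have h4 := hspeed (γ t) (by rw [hB]; linarith) (derivWithin γ (Icc 0 1) t)
      change _ ≤ m * metricSpeed g γ t at h4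
      linarith)
  intro t ht
  refine (key ht).trans ?_
  have h2 := mul_le_mul_of_nonneg_left (hPle t ht) hm.le
  have h3 : ε * t ≤ ε := mul_le_of_le_one_right hε.le ht.2
  linarith

/-- The counterpart of `effClass_eq_of_quotientDist_eq_zero`: the curve is confined to the tube by
its small length, and `c` is constant along it by connectedness of `[0,1]`. -/
theorem effClass_eq_of_metricGeodesicDist_eq_zero (hg : Continuous g) (hF : Differentiable ℝ F)
    (hK : LipschitzWith K (fderiv ℝ F))
    (hX : ∀ w w', w' ∈ setReparams f X w ↔ F w' = F w) {w₀ w₁ : EuclideanSpace ℝ (Fin D)}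
    {ρ M m : ℝ} (hρ : 0 < ρ) (hm : 0 < m)
    (hinv : ∀ w, ‖F w - F w₀‖ < ρ →
      ∃ R : V →L[ℝ] EuclideanSpace ℝ (Fin D), (∀ v, fderiv ℝ F w (R v) = v) ∧ ‖R‖ ≤ M)
    (hspeed : ∀ w, ‖F w - F w₀‖ < ρ → ∀ h : EuclideanSpace ℝ (Fin D),
      ‖fderiv ℝ F w h‖ ≤ m * √(h.ofLp ⬝ᵥ (g w *ᵥ h.ofLp)))
    (hd : metricGeodesicDist g w₀ w₁ = 0) : effClass f X w₀ = effClass f X w₁ := by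
  obtain ⟨ρ', hρ', hρρ', δ, hδ, c, hc0, hc⟩ := exists_locally_constant_class hF hK hX hρ hinv
  have hsmall : ∀ ε > 0, ε < ρ' → ∃ γ : ℝ → EuclideanSpace ℝ (Fin D), ContinuousOn γ (Icc 0 1) ∧
      γ 0 = w₀ ∧ γ 1 = w₁ ∧ ∀ t ∈ Icc (0 : ℝ) 1, ‖F (γ t) - F w₀‖ ≤ ε := by
    intro ε hε hερ
    obtain ⟨r, ⟨γ, hγ, rfl, rfl, rfl⟩, hr⟩ := exists_lt_of_csInf_lt
      -- Half of `ε` pays for the length, the other half for the slack in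
      -- `norm_map_sub_le_of_metricLength`.
      (nonempty_metricLengths g w₀ w₁) (hd.trans_lt (show 0 < ε / (2 * m) by positivity))
    have h1 : m * metricLength g γ < ε / 2 := by
      have := (lt_div_iff₀ (by positivity)).1 hr
      linarith
    refine ⟨γ, hγ.continuousOn, rfl, rfl, fun t ht => ?_⟩
    refine (norm_map_sub_le_of_metricLength hg hF hm (half_pos hε) hspeed hγ
      (by linarith) t ht).trans (by linarith)
  have hFw : F w₁ = F w₀ := by
    by_contra hne
    have hpos : 0 < ‖F w₁ - F w₀‖ := norm_pos_iff.2 (sub_ne_zero.2 hne)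
    obtain ⟨γ, -, -, h1, h2⟩ := hsmall (min (ρ' / 2) (‖F w₁ - F w₀‖ / 2))
      (lt_min (by positivity) (by positivity)) ((min_le_left _ _).trans_lt (by linarith))
    have h3 := (h2 1 (right_mem_Icc.2 zero_le_one)).trans (min_le_right _ _)
    rw [h1] at h3
    linarith
  obtain ⟨γ, hγ, g0, g1, hγF⟩ := hsmall (ρ' / 2) (by positivity) (by linarith)
  rw [← hc0 w₀ rfl, ← hc0 w₁ hFw, ← g0, ← g1]
  exact eq_of_continuousOn_of_locally_constant (S := {w | ‖F w - F w₀‖ < ρ'}) hδ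
    (fun w hw w' hw' => hc w w' hw hw') zero_le_one hγ
    fun t ht => (hγF t ht).trans_lt (by linarith)

end GeodesicDist

/-! ### Right inverses from kernel bounds, and uniform positivity -/

section LinearAlgebra

variable {E V : Type*} [NormedAddCommGroup E] [InnerProductSpace ℝ E]
  [NormedAddCommGroup V] [InnerProductSpace ℝ V] [FiniteDimensional ℝ V]

open scoped InnerProductSpace in
/-- If `B A A† B` is bounded and bounded below and `B` is symmetric, bounded and bounded below,
then `A` is bounded and has a bounded right inverse. -/
theorem exists_rightInverse_of_norm_le_norm_comp {A : E →L[ℝ] V} {A' : V →L[ℝ] E}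
    (hA' : ∀ u v, ⟪A' u, v⟫_ℝ = ⟪u, A v⟫_ℝ) {B : V →L[ℝ] V} (hB : ∀ u v, ⟪B u, v⟫_ℝ = ⟪u, B v⟫_ℝ)
    {a b l L : ℝ} (ha : 0 < a) (hl : 0 < l) (hBa : ∀ v, a * ‖v‖ ^ 2 ≤ ‖B v‖ ^ 2)
    (hBb : ∀ v, ‖B v‖ ^ 2 ≤ b * ‖v‖ ^ 2) (hlow : ∀ v, l * ‖v‖ ≤ ‖B (A (A' (B v)))‖)
    (hup : ∀ v, ‖B (A (A' (B v)))‖ ≤ L * ‖v‖) :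
    ‖A‖ ≤ √|L| / √a ∧ ∃ R : V →L[ℝ] E, (∀ v, A (R v) = v) ∧ ‖R‖ ≤ √|L| * (l⁻¹ * √|b|) := by
  have hBb' : ∀ v, ‖B v‖ ≤ √|b| * ‖v‖ := by
    intro v
    refine le_of_sq_le_sq ?_ (by positivity)
    rw [mul_pow, Real.sq_sqrt (abs_nonneg b)]
    exact (hBb v).trans (mul_le_mul_of_nonneg_right (le_abs_self b) (sq_nonneg _))
  have hBa' : ∀ v, √a * ‖v‖ ≤ ‖B v‖ := by
    intro v
    refine le_of_sq_le_sq ?_ (norm_nonneg _)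
    rw [mul_pow, Real.sq_sqrt ha.le]
    exact hBa v
  have hadj : ∀ u v, ⟪A' (B u), v⟫_ℝ = ⟪u, B (A v)⟫_ℝ := fun u v => by rw [hA', hB]
  -- `‖A' (B v)‖²` is the quadratic form of `B A A' B` at `v`. The absolute value is there because
  -- no sign of `L` is assumed.
  have hC : ∀ v, ‖A' (B v)‖ ≤ √|L| * ‖v‖ := by
    intro v
    refine le_of_sq_le_sq ?_ (by positivity)
    rw [mul_pow, Real.sq_sqrt (abs_nonneg L), ← real_inner_self_eq_norm_sq, hadj]
    have h1 := (real_inner_le_norm v (B (A (A' (B v))))).trans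
      (mul_le_mul_of_nonneg_left (hup v) (norm_nonneg v))
    have h2 := mul_le_mul_of_nonneg_right (le_abs_self L) (sq_nonneg ‖v‖)
    nlinarith
  have hBinj : Function.Injective B := by
    refine (injective_iff_map_eq_zero B).2 fun v hv => ?_
    have h := hBa v
    rw [hv, norm_zero] at h
    have : ‖v‖ ^ 2 = 0 := by nlinarith [sq_nonneg ‖v‖]
    simpa using this
  constructor
  · refine A.opNorm_le_bound (by positivity) fun v => ?_
    have h1 : ‖B (A v)‖ ≤ √|L| * ‖v‖ := by
      by_cases h0 : ‖B (A v)‖ = 0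
      · rw [h0]; positivity
      -- `B A` is the adjoint of `A' B`, so it inherits the bound `hC` by duality.
      · have h2 : ‖B (A v)‖ * ‖B (A v)‖ ≤ (√|L| * ‖B (A v)‖) * ‖v‖ := by
          rw [← real_inner_self_eq_norm_mul_norm, ← hadj]
          exact (real_inner_le_norm _ _).trans
            (mul_le_mul_of_nonneg_right (hC _) (norm_nonneg v))
        have h3 : 0 < ‖B (A v)‖ := lt_of_le_of_ne (norm_nonneg _) (Ne.symm h0)
        nlinarith
    rw [div_mul_eq_mul_div, le_div_iff₀ (Real.sqrt_pos.2 ha), mul_comm]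
    exact (hBa' _).trans h1
  · let T : V →L[ℝ] V := B ∘L A ∘L A' ∘L B
    have hTinj : Function.Injective T := by
      refine (injective_iff_map_eq_zero T).2 fun v hv => ?_
      have h := hlow v
      change B (A (A' (B v))) = 0 at hv
      rw [hv, norm_zero] at h
      have : ‖v‖ = 0 := le_antisymm (by nlinarith) (norm_nonneg v)
      simpa using this
    let e : V ≃L[ℝ] V :=
      (LinearEquiv.ofInjectiveEndo (T : V →ₗ[ℝ] V) hTinj).toContinuousLinearEquiv
    have he : ∀ v, B (A (A' (B (e.symm v)))) = v := fun v => e.apply_symm_apply v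
    -- With `T = B A A' B`, the candidate is `R = A' B T⁻¹ B`; then `B A R = B`, and injectivity of
    -- `B` cancels it.
    refine ⟨A' ∘L B ∘L (e.symm : V →L[ℝ] V) ∘L B, fun v => hBinj (he (B v)), ?_⟩
    refine ContinuousLinearMap.opNorm_le_bound _ (by positivity) fun v => ?_
    have h1 : ‖e.symm (B v)‖ ≤ l⁻¹ * ‖B v‖ := by
      have := hlow (e.symm (B v))
      rw [he] at this
      rwa [inv_mul_eq_div, le_div_iff₀ hl, mul_comm]
    calc ‖A' (B (e.symm (B v)))‖ ≤ √|L| * ‖e.symm (B v)‖ := hC _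
      _ ≤ √|L| * (l⁻¹ * (√|b| * ‖v‖)) := by
        gcongr
        exact h1.trans (by gcongr; exact hBb' v)
      _ = _ := by ring

end LinearAlgebra

/-- A continuous family of matrices is, as a family of quadratic forms, uniformly bounded and
uniformly bounded below near a point where it is positive definite. -/
theorem exists_uniform_bounds_of_posDef {Z ι : Type*} [SeminormedAddCommGroup Z] [Fintype ι]
    [DecidableEq ι] {S : Z → Matrix ι ι ℝ} (hS : Continuous S) {z₀ : Z} (h₀ : (S z₀).PosDef) :
    ∃ ρ > 0, ∃ a > 0, ∃ b > 0, ∀ z, ‖z - z₀‖ < ρ → ∀ v : EuclideanSpace ℝ ι,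
      a * ‖v‖ ^ 2 ≤ v.ofLp ⬝ᵥ (S z *ᵥ v.ofLp) ∧ v.ofLp ⬝ᵥ (S z *ᵥ v.ofLp) ≤ b * ‖v‖ ^ 2 := by
  let T : Z → EuclideanSpace ℝ ι →L[ℝ] EuclideanSpace ℝ ι :=
    fun z => Matrix.toEuclideanCLM (n := ι) (𝕜 := ℝ) (S z)
  have hT : Continuous T :=
    (LinearMap.continuous_of_finiteDimensional
      { toFun := Matrix.toEuclideanCLM (n := ι) (𝕜 := ℝ)
        map_add' := map_add _
        map_smul' := map_smul _ }).comp hS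
  have hTS : ∀ z v, inner ℝ v (T z v) = v.ofLp ⬝ᵥ (S z *ᵥ v.ofLp) :=
    fun z v => Matrix.inner_toEuclideanCLM _ _ _
  obtain ⟨a, ha, hla⟩ := (isCompact_sphere (0 : EuclideanSpace ℝ ι) 1).exists_forall_le'
    (f := fun v => inner ℝ v (T z₀ v)) (a := 0) (by fun_prop) (fun v hv => by
      rw [hTS]
      have hv0 : v ≠ 0 := ne_zero_of_mem_unit_sphere ⟨v, hv⟩
      simpa using h₀.dotProduct_mulVec_pos (x := v.ofLp) (by simpa using hv0))
  have hla' : ∀ v, a * ‖v‖ ^ 2 ≤ inner ℝ v (T z₀ v) := by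
    intro v
    by_cases hv : v = 0
    · simp [hv]
    · have hn : ‖v‖ ≠ 0 := norm_ne_zero_iff.2 hv
      have h := hla (‖v‖⁻¹ • v) (by simp [norm_smul, hn])
      rw [map_smul, real_inner_smul_left, real_inner_smul_right] at h
      have h2 := mul_le_mul_of_nonneg_right h (sq_nonneg ‖v‖)
      field_simp at h2
      exact h2
  obtain ⟨ρ, hρ, hball⟩ := Metric.continuous_iff.1 hT z₀ (a / 2) (half_pos ha)
  -- The form at `z₀` is at least `a` on the unit sphere, and perturbing the operator by at most `a
  -- / 2` leaves `a / 2`.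
  refine ⟨ρ, hρ, a / 2, half_pos ha, ‖T z₀‖ + a, by positivity, fun z hz v => ?_⟩
  have h1 : ‖T z - T z₀‖ ≤ a / 2 := by
    rw [← dist_eq_norm]
    exact (hball z (by rwa [dist_eq_norm])).le
  have h2 : |inner ℝ v ((T z - T z₀) v)| ≤ a / 2 * ‖v‖ ^ 2 := by
    have e1 := (abs_real_inner_le_norm v ((T z - T z₀) v)).trans
      (mul_le_mul_of_nonneg_left ((T z - T z₀).le_of_opNorm_le h1 v) (norm_nonneg v))
    linarith
  have h3 : inner ℝ v (T z₀ v) ≤ ‖T z₀‖ * ‖v‖ ^ 2 := by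
    have e1 := (real_inner_le_norm v (T z₀ v)).trans
      (mul_le_mul_of_nonneg_left ((T z₀).le_opNorm v) (norm_nonneg v))
    linarith
  rw [sub_apply, inner_sub_right, abs_le] at h2
  rw [← hTS]
  have h4 := hla' v
  have h5 : 0 ≤ a * ‖v‖ ^ 2 := by positivity
  constructor
  · linarith [h2.1]
  · rw [add_mul]
    linarith [h2.2]

/-! ### The stacked model, its NTK and its GGN metric -/

section Model

variable {D I O N : ℕ} {Y : Type*}
  {f : EuclideanSpace ℝ (Fin D) → EuclideanSpace ℝ (Fin I) → EuclideanSpace ℝ (Fin O)}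
  {p : Y → EuclideanSpace ℝ (Fin O) → ℝ}
  {x : Fin N → EuclideanSpace ℝ (Fin I)} {y : Fin N → Y}

/-- The continuous linear map stacking `N` vectors of length `O`. -/
noncomputable def stackCLM (N O : ℕ) :
    (Fin N → EuclideanSpace ℝ (Fin O)) →L[ℝ] EuclideanSpace ℝ (Fin N × Fin O) :=
  LinearMap.toContinuousLinearMap
    { toFun := fun u => WithLp.toLp 2 fun k => u k.1 k.2
      map_add' := fun _ _ => rfl
      map_smul' := fun _ _ => rfl }

/-- The stacking of the predictions on the training set. -/
noncomputable def stackedModel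
    (f : EuclideanSpace ℝ (Fin D) → EuclideanSpace ℝ (Fin I) → EuclideanSpace ℝ (Fin O))
    (x : Fin N → EuclideanSpace ℝ (Fin I)) (w : EuclideanSpace ℝ (Fin D)) :
    EuclideanSpace ℝ (Fin N × Fin O) :=
  stackCLM N O fun n => f w (x n)

theorem mem_setReparams_range {w w' : EuclideanSpace ℝ (Fin D)} :
    w' ∈ setReparams f (Set.range x) w ↔ stackedModel f x w' = stackedModel f x w := by
  rw [mem_setReparams, forall_mem_range]
  constructor
  · intro h
    simp only [stackedModel, h]
  · intro h n
    ext o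
    exact congrArg (fun u : EuclideanSpace ℝ (Fin N × Fin O) => u (n, o)) h

theorem hasFDerivAt_stackedModel (hf : ∀ n, Differentiable ℝ (fun w => f w (x n)))
    (w : EuclideanSpace ℝ (Fin D)) :
    HasFDerivAt (stackedModel f x)
      (stackCLM N O ∘L ContinuousLinearMap.pi fun n => fderiv ℝ (fun v => f v (x n)) w) w :=
  (stackCLM N O).hasFDerivAt.comp w (hasFDerivAt_pi.2 fun n => (hf n w).hasFDerivAt)

theorem lipschitzWith_fderiv_stackedModel (hf : ∀ n, Differentiable ℝ (fun w => f w (x n)))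
    (hJ : ∀ n, ∃ K : ℝ≥0, LipschitzWith K (fun w => fderiv ℝ (fun v => f v (x n)) w)) :
    ∃ K : ℝ≥0, LipschitzWith K (fderiv ℝ (stackedModel f x)) := by
  choose K hK using hJ
  refine ⟨‖stackCLM N O‖₊ * ∑ n, K n, LipschitzWith.of_dist_le_mul fun w w' => ?_⟩
  rw [(hasFDerivAt_stackedModel hf w).fderiv, (hasFDerivAt_stackedModel hf w').fderiv,
    dist_eq_norm, ← ContinuousLinearMap.comp_sub, NNReal.coe_mul, mul_assoc]
  refine (ContinuousLinearMap.opNorm_comp_le _ _).trans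
    (mul_le_mul_of_nonneg_left ?_ (norm_nonneg _))
  refine ContinuousLinearMap.opNorm_le_bound _ (by positivity) fun v => ?_
  refine (pi_norm_le_iff_of_nonneg (by positivity)).2 fun n => ?_
  have h := (hK n).dist_le_mul w w'
  rw [dist_eq_norm] at h
  refine (ContinuousLinearMap.le_of_opNorm_le _ h v).trans ?_
  gcongr
  exact Finset.single_le_sum (f := K) (fun _ _ => zero_le) (Finset.mem_univ n)

theorem stackedJacobian_mulVec (hf : ∀ n, Differentiable ℝ (fun w => f w (x n)))
    (w v : EuclideanSpace ℝ (Fin D)) :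
    stackedJacobian f x w *ᵥ v.ofLp = (fderiv ℝ (stackedModel f x) w v).ofLp := by
  rw [(hasFDerivAt_stackedModel hf w).fderiv]
  ext k
  change ∑ j, fderiv ℝ (fun v => f v (x k.1)) w (EuclideanSpace.single j 1) k.2 * v j =
    fderiv ℝ (fun v => f v (x k.1)) w v k.2
  conv_rhs => rw [← (EuclideanSpace.basisFun (Fin D) ℝ).sum_repr v]
  simp [mul_comm]

/-- The Hessian of the negative log-likelihood as a function of the stacked predictions. -/
noncomputable def outputHessian (p : Y → EuclideanSpace ℝ (Fin O) → ℝ) (y : Fin N → Y)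
    (z : EuclideanSpace ℝ (Fin N × Fin O)) : Matrix (Fin N × Fin O) (Fin N × Fin O) ℝ :=
  Matrix.of fun k k' => if k.1 = k'.1 then
    negLogLikHessian p (y k.1) (WithLp.toLp 2 fun o => z (k.1, o)) k.2 k'.2 else 0

/-- This factorization through the predictions is what makes Hessian bounds near one output value
uniform along an entire, possibly noncompact, fibre. -/
theorem stackedHessian_eq (w : EuclideanSpace ℝ (Fin D)) :
    stackedHessian f p x y w = outputHessian p y (stackedModel f x w) := rfl

theorem continuous_outputHessian (hp2 : ∀ c, ContDiff ℝ 2 (fun z => Real.log (p c z))) :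
    Continuous (outputHessian p y) := by
  refine continuous_matrix fun k k' => ?_
  simp only [outputHessian, Matrix.of_apply]
  split_ifs
  · have h1 : Continuous fun z =>
        fderiv ℝ (fun z' => fderiv ℝ (fun u => Real.log (p (y k.1) u)) z') z :=
      ((hp2 (y k.1)).fderiv_right (m := 1) (by norm_num)).continuous_fderiv (by norm_num)
    have h2 : Continuous fun z : EuclideanSpace ℝ (Fin N × Fin O) =>
        (WithLp.toLp 2 fun o => z (k.1, o) : EuclideanSpace ℝ (Fin O)) := by fun_prop
    exact (((h1.comp h2).clm_apply continuous_const).clm_apply continuous_const).neg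
  · exact continuous_const

theorem continuous_ggn (hf : ∀ n, Differentiable ℝ (fun w => f w (x n)))
    (hJ : ∀ n, ∃ K : ℝ≥0, LipschitzWith K (fun w => fderiv ℝ (fun v => f v (x n)) w))
    (hp2 : ∀ c, ContDiff ℝ 2 (fun z => Real.log (p c z))) : Continuous (ggn f p x y) := by
  have h1 : Continuous (stackedJacobian f x) := by
    refine continuous_matrix fun k j => ?_
    obtain ⟨K, hK⟩ := hJ k.1
    have h := hK.continuous.clm_apply
      (continuous_const (y := (EuclideanSpace.single j 1 : EuclideanSpace ℝ (Fin D))))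
    exact (PiLp.continuous_apply 2 _ k.2).comp h
  have hF : Differentiable ℝ (stackedModel f x) :=
    fun w => (hasFDerivAt_stackedModel hf w).differentiableAt
  have h2 : Continuous (stackedHessian f p x y) :=
    (continuous_outputHessian hp2).comp hF.continuous
  exact (h1.matrix_transpose.matrix_mul h2).matrix_mul h1

theorem dotProduct_ggn_mulVec (hf : ∀ n, Differentiable ℝ (fun w => f w (x n)))
    (w h : EuclideanSpace ℝ (Fin D)) :
    h.ofLp ⬝ᵥ (ggn f p x y w *ᵥ h.ofLp) =
      (fderiv ℝ (stackedModel f x) w h).ofLp ⬝ᵥ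
        (stackedHessian f p x y w *ᵥ (fderiv ℝ (stackedModel f x) w h).ofLp) := by
  rw [← stackedJacobian_mulVec hf, ggn, ← Matrix.mulVec_mulVec, ← Matrix.mulVec_mulVec,
    Matrix.dotProduct_mulVec, Matrix.vecMul_transpose]

/-- Near a level set of the stacked model its Jacobian is uniformly bounded with uniformly
bounded right inverses, and the GGN speed is comparable with the Euclidean speed of the
predictions. -/
theorem exists_uniform_bounds_near_fiber (hf : ∀ n, Differentiable ℝ (fun w => f w (x n)))
    (hp2 : ∀ c, ContDiff ℝ 2 (fun z => Real.log (p c z)))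
    (hH : ∀ w, (stackedHessian f p x y w).PosDef) {l L : ℝ} (hl : 0 < l)
    (hntk : ∀ (w : EuclideanSpace ℝ (Fin D)) (v : EuclideanSpace ℝ (Fin N × Fin O)),
      l * ‖v‖ ≤ ‖(WithLp.toLp 2 (ntk f p x y w *ᵥ v.ofLp) : EuclideanSpace ℝ (Fin N × Fin O))‖ ∧
      ‖(WithLp.toLp 2 (ntk f p x y w *ᵥ v.ofLp) : EuclideanSpace ℝ (Fin N × Fin O))‖ ≤ L * ‖v‖)
    (w₀ : EuclideanSpace ℝ (Fin D)) :
    ∃ ρ > 0, ∃ M > 0, ∀ w, ‖stackedModel f x w - stackedModel f x w₀‖ < ρ →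
      (∃ R : EuclideanSpace ℝ (Fin N × Fin O) →L[ℝ] EuclideanSpace ℝ (Fin D),
        (∀ v, fderiv ℝ (stackedModel f x) w (R v) = v) ∧ ‖R‖ ≤ M) ∧
      ‖fderiv ℝ (stackedModel f x) w‖ ≤ M ∧
      ∀ h : EuclideanSpace ℝ (Fin D),
        √(h.ofLp ⬝ᵥ (ggn f p x y w *ᵥ h.ofLp)) ≤ M * ‖fderiv ℝ (stackedModel f x) w h‖ ∧
        ‖fderiv ℝ (stackedModel f x) w h‖ ≤ M * √(h.ofLp ⬝ᵥ (ggn f p x y w *ᵥ h.ofLp)) := by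
  obtain ⟨ρ, hρ, a, ha, b, hb, hab⟩ := exists_uniform_bounds_of_posDef
    (continuous_outputHessian (y := y) hp2) (z₀ := stackedModel f x w₀) (hH w₀)
  have hsa : 0 < √a := Real.sqrt_pos.2 ha
  -- The summands bound, in order, the Jacobian, its right inverse, the GGN speed by the output
  -- speed, and the output speed by the GGN speed.
  refine ⟨ρ, hρ, √|L| / √a + √|L| * (l⁻¹ * √|b|) + √b + (√a)⁻¹, by positivity, fun w hw => ?_⟩
  have hab' := hab _ hw
  rw [← stackedHessian_eq] at hab'
  set A := fderiv ℝ (stackedModel f x) w with hA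
  set S := CFC.sqrt (stackedHessian f p x y w) with hSdef
  have hSS : S * S = stackedHessian f p x y w :=
    CFC.sqrt_mul_sqrt_self _ (Matrix.nonneg_iff_posSemidef.2 (hH w).posSemidef)
  have hST : Sᵀ = S := by
    have h := (Matrix.nonneg_iff_posSemidef.1
      (CFC.sqrt_nonneg (stackedHessian f p x y w))).isHermitian
    rwa [Matrix.IsHermitian, Matrix.conjTranspose_eq_transpose_of_trivial] at h
  -- With `B = H^{1/2}`, `‖B v‖²` is the Hessian form at `v` and `B A A† B` is the NTK.
  let B := Matrix.toEuclideanCLM (n := Fin N × Fin O) (𝕜 := ℝ) S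
  have hB : ∀ u v, inner ℝ (B u) v = inner ℝ u (B v) := by
    intro u v
    rw [Matrix.inner_toEuclideanCLM, real_inner_comm, Matrix.inner_toEuclideanCLM,
      Matrix.dotProduct_mulVec, ← Matrix.mulVec_transpose, hST, dotProduct_comm]
  have hBB : ∀ v, ‖B v‖ ^ 2 = v.ofLp ⬝ᵥ (stackedHessian f p x y w *ᵥ v.ofLp) := by
    intro v
    rw [← real_inner_self_eq_norm_sq, hB, ← hSS, ← Matrix.mulVec_mulVec]
    exact Matrix.inner_toEuclideanCLM _ _ _
  let A' := ContinuousLinearMap.adjoint A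
  have hA' : ∀ u, (A' u).ofLp = (stackedJacobian f x w)ᵀ *ᵥ u.ofLp := by
    intro u
    have : A' u = WithLp.toLp 2 ((stackedJacobian f x w)ᵀ *ᵥ u.ofLp) := by
      refine ext_inner_right ℝ fun v => ?_
      rw [ContinuousLinearMap.adjoint_inner_left, EuclideanSpace.inner_eq_star_dotProduct,
        EuclideanSpace.inner_eq_star_dotProduct, ← stackedJacobian_mulVec hf]
      simp only [star_trivial]
      rw [Matrix.mulVec_transpose, dotProduct_comm, Matrix.dotProduct_mulVec, dotProduct_comm]
    rw [this]
  have hBAB : ∀ v, B (A (A' (B v))) = WithLp.toLp 2 (ntk f p x y w *ᵥ v.ofLp) := by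
    intro v
    have : (B (A (A' (B v)))).ofLp = ntk f p x y w *ᵥ v.ofLp := by
      rw [ntk, ← Matrix.mulVec_mulVec, ← Matrix.mulVec_mulVec, ← Matrix.mulVec_mulVec,
        Matrix.ofLp_toEuclideanCLM, ← stackedJacobian_mulVec hf, hA', Matrix.ofLp_toEuclideanCLM]
    rw [← this]
  obtain ⟨h1, R, hR, h2⟩ := exists_rightInverse_of_norm_le_norm_comp (A := A) (A' := A')
    (fun u v => ContinuousLinearMap.adjoint_inner_left A v u) hB ha hl
    (fun v => by rw [hBB]; exact (hab' v).1) (fun v => by rw [hBB]; exact (hab' v).2)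
    (fun v => by rw [hBAB]; exact (hntk w v).1) (fun v => by rw [hBAB]; exact (hntk w v).2)
  have p1 : 0 ≤ √|L| / √a := by positivity
  have p2 : 0 ≤ √|L| * (l⁻¹ * √|b|) := by positivity
  have p3 : 0 ≤ √b := by positivity
  have p4 : 0 ≤ (√a)⁻¹ := by positivity
  refine ⟨⟨R, hR, by linarith⟩, by linarith, fun h => ?_⟩
  rw [dotProduct_ggn_mulVec hf, ← hA]
  obtain ⟨q1, q2⟩ := hab' (A h)
  constructor
  · have e1 := Real.sqrt_le_sqrt q2
    rw [Real.sqrt_mul hb.le, Real.sqrt_sq (norm_nonneg _)] at e1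
    exact e1.trans (mul_le_mul_of_nonneg_right (by linarith) (norm_nonneg _))
  · have e1 := Real.sqrt_le_sqrt q1
    rw [Real.sqrt_mul ha.le, Real.sqrt_sq (norm_nonneg _)] at e1
    refine le_trans ?_ (mul_le_mul_of_nonneg_right
      (show (√a)⁻¹ ≤ _ by linarith) (Real.sqrt_nonneg _))
    rwa [inv_mul_eq_div, le_div_iff₀ hsa, mul_comm]

end Model


theorem mainTheorem2 {D I O N : ℕ} {Y : Type*}
    (f : EuclideanSpace ℝ (Fin D) → EuclideanSpace ℝ (Fin I) → EuclideanSpace ℝ (Fin O))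
    (p : Y → EuclideanSpace ℝ (Fin O) → ℝ)
    (x : Fin N → EuclideanSpace ℝ (Fin I)) (y : Fin N → Y)
    (hf : ∀ n, Differentiable ℝ (fun w => f w (x n)))
    (hJ : ∀ n, ∃ K : ℝ≥0, LipschitzWith K (fun w => fderiv ℝ (fun v => f v (x n)) w))
    (hp : ∀ c z, 0 < p c z)
    (hp2 : ∀ c, ContDiff ℝ 2 (fun z => Real.log (p c z)))
    (hHy : ∀ c c' z, negLogLikHessian p c z = negLogLikHessian p c' z)
    (hH : ∀ w, (stackedHessian f p x y w).PosDef)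
    (l L : ℝ) (hl : 0 < l)
    (hntk : ∀ (w : EuclideanSpace ℝ (Fin D)) (v : EuclideanSpace ℝ (Fin N × Fin O)),
      l * ‖v‖ ≤ ‖(WithLp.toLp 2 (ntk f p x y w *ᵥ v.ofLp) : EuclideanSpace ℝ (Fin N × Fin O))‖ ∧
      ‖(WithLp.toLp 2 (ntk f p x y w *ᵥ v.ofLp) : EuclideanSpace ℝ (Fin N × Fin O))‖ ≤ L * ‖v‖)
    (w₀ w₁ : EuclideanSpace ℝ (Fin D)) :
    (metricGeodesicDist (ggn f p x y) w₀ w₁ = 0 ↔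
      effClass f (Set.range x) w₀ = effClass f (Set.range x) w₁) ∧
    (effClass f (Set.range x) w₀ = effClass f (Set.range x) w₁ ↔
      quotientDist f (Set.range x) (effClass f (Set.range x) w₀)
        (effClass f (Set.range x) w₁) = 0) := by
  have hF : Differentiable ℝ (stackedModel f x) :=
    fun w => (hasFDerivAt_stackedModel hf w).differentiableAt
  obtain ⟨K, hK⟩ := lipschitzWith_fderiv_stackedModel hf hJ
  have hX : ∀ w w', w' ∈ setReparams f (Set.range x) w ↔
      stackedModel f x w' = stackedModel f x w := fun _ _ => mem_setReparams_range
  have hg : Continuous (ggn f p x y) := continuous_ggn hf hJ hp2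
  obtain ⟨ρ, hρ, M, hM, h⟩ := exists_uniform_bounds_near_fiber hf hp2 hH hl hntk w₀
  refine ⟨⟨fun hd => ?_, fun hc => ?_⟩, fun hc => ?_, fun hd => ?_⟩
  · exact effClass_eq_of_metricGeodesicDist_eq_zero hg hF hK hX hρ hM (fun w hw => (h w hw).1)
      (fun w hw v => ((h w hw).2.2 v).2) hd
  · exact metricGeodesicDist_eq_zero_of_effClass_eq hg hF hK hX hρ hM.le
      (fun w hw v => ((h w hw).2.2 v).1) hc
  · rw [← hc]
    exact quotientDist_self w₀
  · exact effClass_eq_of_quotientDist_eq_zero hF hK hX hρ (fun w hw => (h w hw).1)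
      (fun w hw => (h w hw).2.1) hd
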